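/- **Language.** Base types are $A,B ::= I \mid A\oplus B\mid A\otimes B\mid X\mid \mu X.A$, iso types are $T ::= A\leftrightarrow B \mid T_1\to T_2$. Terms are $$t ::= * \mid x \mid \mathtt{inl}\,t\mid \mathtt{inr}\,t\mid t_1\otimes t_2\mid \mathtt{fold}\,t\mid \omega\,t\mid \mathtt{let}\ p=t_1\ \mathtt{in}\ t_2,$$ where patterns are $p ::= x\mid p_1\otimes p_2$, and isos are $$\omega ::= \{v_i\leftrightarrow e_i\}_{i\in I}\mid \mathtt{fix}\,\phi.\omega\mid\lambda\phi.\omega\mid\phi\mid\omega_1\omega_2\qquad (I\text{ finite}).$$ Values $v$ are the terms built from $*$, variables, $\mathtt{inl}$, $\mathtt{inr}$, $\otimes$, $\mathtt{fold}$; expressions are $e ::= v\mid \mathtt{let}\ p_1=\omega\,p_2\ \mathtt{in}\ e$. Judgements are $\Psi;\Delta\vdash t:A$ and $\Psi\vdash_\omega\omega:T$, where $\Delta$ is a linear context of term variables of closed types (every variable is used exactly once, contexts are taken up to exchange) and $\Psi$ is a non-linear context of iso-variables; in $\mathtt{fold}\,t:\mu X.A$ one has $t:A[\mu X.A/X]$.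 Orthogonality $\bot$ is the smallest symmetric relation on terms of the same type with $\mathtt{inl}\,t_1\bot\mathtt{inr}\,t_2$ that is closed under $\mathtt{inl}$, $\mathtt{inr}$, $\mathtt{fold}$, $t_1\otimes u_1\,\bot\,t_2\otimes u_2$ and $u_1\otimes t_1\,\bot\,u_2\otimes t_2$ (with $u_1,u_2$ arbitrary), and under prefixing either side with $\mathtt{let}\ p=u\ \mathtt{in}\ (-)$. The iso $\{v_i\leftrightarrow e_i\}_{i\in I}:A\leftrightarrow B$ is well formed if for each $i$ there is $\Delta_i$ with $\Psi;\Delta_i\vdash v_i:A$ and $\Psi;\Delta_i\vdash e_i:B$, $v_i$ a value, $e_i$ an expression, and $v_i\bot v_j$, $e_i\bot e_j$ for all $i\ne j$. **Evaluation.** On isos, $\to$ is generated by $\mathtt{fix}\,\phi.\omega\to\omega[\mathtt{fix}\,\phi.\omega/\phi]$, $(\lambda\phi.\omega_1)\omega_2\to\omega_1[\omega_2/\phi]$, and $\omega_1\omega_2\to\omega_1'\omega_2$ if $\omega_1\to\omega_1'$. On closed terms it is generated by $\omega\,t\to\omega'\,t$ if $\omega\to\omega'$; $\{v_i\leftrightarrow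 e_i\}_i\,v\to\sigma(e_i)$ if the value $v$ matches $v_i$ with substitution $\sigma$; $\mathtt{let}\ p=v\ \mathtt{in}\ t\to\sigma(t)$ if the value $v$ matches $p$ with $\sigma$; and closure under the contexts $\mathtt{inl}\,[\,]$, $\mathtt{inr}\,[\,]$, $\mathtt{fold}\,[\,]$, $[\,]\otimes t$, $v\otimes[\,]$, $\{v_i\leftrightarrow e_i\}_i\,[\,]$, $\mathtt{let}\ p=[\,]\ \mathtt{in}\ t$. A closed term terminates, $t\downarrow$, if $t\to^* v$ for a value $v$. **Categories.** An inverse category is a restriction category in which every $f:X\to Y$ has a unique partial inverse $f^\circ:Y\to X$, i.e. $f^\circ f=\overline f$ and $ff^\circ=\overline{f^\circ}$. Hom-sets are ordered by $f\le g\iff g\overline f=f$. Parallel $f,g$ are inverse compatible if $f\overline g=g\overline f$ and $f^\circ\overline{g^\circ}=g^\circ\overline{f^\circ}$. It is a join inverse category if every pairwise inverse compatible set of parallel morphisms has a join for $\le$, and these joins commute with restriction and with composition on both sides; the empty join is written $0$. A join inverse rig category has in addition a symmetric monoidal structure $(\otimes,1)$ and a disjointness tensor $(\oplus,0)$, i.e.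 a symmetric monoidal structure whose unit is a restriction zero, with total injections $\iota_l:X\to X\oplus Y$, $\iota_r:Y\to X\oplus Y$ that are jointly epic, whose partial inverses are jointly monic, and that satisfy $\overline{\iota_l^\circ}\;\overline{\iota_r^\circ}=0$; both $\otimes$ and $\oplus$ preserve restrictions and, in each variable, nonempty joins; and there are isomorphisms $A\otimes(B\oplus D)\cong(A\otimes B)\oplus(A\otimes D)$ and $A\otimes 0\cong 0$. Let $\mathcal C$ be a join inverse rig category with colimits of $\omega$-chains of embeddings ($e$ is an embedding if $pe=\mathrm{id}$ and $ep\le\mathrm{id}$ for some $p$). Its hom-sets are pointed dcpos, and every dcpo-functor $F:\mathcal D\times\mathcal C\to\mathcal C$ ($\mathcal D$ a category whose hom-sets are ordered; a dcpo-functor is a functor that is Scott continuous on hom-sets) has a parametrised initial algebra $F^\sharp:\mathcal D\to\mathcal C$, where $F^\sharp d$ is the initial algebra of $F(d,-)$, with structure map $\alpha$. **Semantics.** Types are interpreted as dcpo-functors $\mathcal C^n\to\mathcal C$: projections for variables, the constant $1$ for $I$, $\oplus$ and $\otimes$ for sums and products, and $[\![\mu X.A]\!]=[\![A]\!]^\sharp$;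 $[\![\Delta]\!]$ is the $\otimes$-product of its types, $[\![A\leftrightarrow B]\!]=\mathcal C([\![A]\!],[\![B]\!])$, $[\![T_1\to T_2]\!]$ is the dcpo of Scott continuous maps, and $[\![\Psi]\!]$ is the product of its types. Terms are interpreted as Scott continuous maps $[\![\Psi]\!]\to\mathcal C([\![\Delta]\!],[\![A]\!])$ and isos as Scott continuous maps $[\![\Psi]\!]\to[\![T]\!]$, by induction (up to the coherence isomorphisms of $\otimes$): $[\![*]\!]=\mathrm{id}$, $[\![x]\!]=\mathrm{id}$, $[\![\mathtt{inl}\,t]\!]=\iota_l[\![t]\!]$, $[\![\mathtt{inr}\,t]\!]=\iota_r[\![t]\!]$, $[\![t_1\otimes t_2]\!]=[\![t_1]\!]\otimes[\![t_2]\!]$, $[\![\mathtt{fold}\,t]\!]=\alpha[\![t]\!]$, $[\![\omega\,t]\!]=[\![\omega]\!][\![t]\!]$, $[\![\mathtt{let}\ p=t_1\ \mathtt{in}\ t_2]\!]=[\![t_2]\!]([\![t_1]\!]\otimes\mathrm{id})$; iso-variables, application, abstraction and $\mathtt{fix}$ are projections, evaluation, currying and least fixed points in dcpos, and $$[\![\{v_i\leftrightarrow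 e_i\}_{i\in I}]\!](g)=\bigvee_{i\in I}[\![e_i]\!](g)\circ[\![v_i]\!](g)^\circ .$$ **Proposition (Soundness).** For all well-typed terms: 1. If $\Psi;\Delta_1\vdash t_1:A$, $\Psi;\Delta_2\vdash t_2:A$ and $t_1\bot t_2$, then $[\![t_1]\!](g)^\circ\circ[\![t_2]\!](g)=0$ for all $g\in[\![\Psi]\!]$. 2. If $\Psi\vdash_\omega\{v_i\leftrightarrow e_i\}_{i\in I}:A\leftrightarrow B$, then for all $g\in[\![\Psi]\!]$ the morphisms $[\![e_i]\!](g)\circ[\![v_i]\!](g)^\circ$, $i\in I$, are pairwise inverse compatible, and $[\![\{v_i\leftrightarrow e_i\}_{i\in I}]\!](g)$ is their join; so the semantics is well defined. 3. If $\vdash t:A$ and $t\to t'$, then $\vdash t':A$ and $[\![t]\!]=[\![t']\!]$. 4. If the objects $0$ and $1$ of $\mathcal C$ are not isomorphic, $\vdash t:A$ and $t\downarrow$, then $[\![t]\!]\ne 0$. -/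

import Mathlib

universe u v

open CategoryTheory MonoidalCategory

namespace RevIso

/-! ### Join inverse categories

Composition is written in diagrammatic order: `f ≫ g` is `g ∘ f`. -/

/-- A restriction structure on a category. -/
class RestrictionCategory (C : Type u) [Category.{v} C] where
  res : ∀ {X Y : C}, (X ⟶ Y) → (X ⟶ X)
  res_comp_self : ∀ {X Y : C} (f : X ⟶ Y), res f ≫ f = f
  res_comm : ∀ {X Y Z : C} (f : X ⟶ Y) (g : X ⟶ Z), res f ≫ res g = res g ≫ res f
  res_res_comp : ∀ {X Y Z : C} (f : X ⟶ Y) (g : X ⟶ Z), res (res g ≫ f) = res g ≫ res f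
  comp_res : ∀ {X Y Z : C} (f : X ⟶ Y) (h : Y ⟶ Z), f ≫ res h = res (f ≫ h) ≫ f

open RestrictionCategory

/-- A morphism is total if its restriction is the identity. -/
def Total {C : Type u} [Category.{v} C] [RestrictionCategory C] {X Y : C} (f : X ⟶ Y) : Prop :=
  res f = 𝟙 X

/-- Restriction compatible parallel morphisms. -/
def RestrictionCompatible {C : Type u} [Category.{v} C] [RestrictionCategory C] {X Y : C}
    (f g : X ⟶ Y) : Prop :=
  res g ≫ f = res f ≫ g

/-- An inverse category: a restriction category in which every morphism `f` has a unique partial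
inverse `g`, that is, `g ∘ f` is the restriction of `f` and `f ∘ g` is the restriction of `g`. -/
class InverseCategory (C : Type u) [Category.{v} C] extends RestrictionCategory C where
  existsUnique_pinv : ∀ {X Y : C} (f : X ⟶ Y), ∃! g : Y ⟶ X, f ≫ g = res f ∧ g ≫ f = res g

/-- The partial inverse `f°`. -/
noncomputable def pinv {C : Type u} [Category.{v} C] [InverseCategory C] {X Y : C}
    (f : X ⟶ Y) : Y ⟶ X :=
  (InverseCategory.existsUnique_pinv f).choose

/-- Inverse compatible parallel morphisms. -/
def InverseCompatible {C : Type u} [Category.{v} C] [InverseCategory C] {X Y : C}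
    (f g : X ⟶ Y) : Prop :=
  RestrictionCompatible f g ∧ RestrictionCompatible (pinv f) (pinv g)

/-- A set of parallel morphisms that are pairwise inverse compatible. -/
def CompatibleSet {C : Type u} [Category.{v} C] [InverseCategory C] {X Y : C}
    (S : Set (X ⟶ Y)) : Prop :=
  ∀ f ∈ S, ∀ g ∈ S, InverseCompatible f g

/-- A category whose hom-sets are partially ordered. -/
class HomOrder (D : Type u) [Category.{v} D] where
  po : ∀ X Y : D, PartialOrder (X ⟶ Y)

attribute [reducible, instance] HomOrder.po

section Inverse

variable {C : Type u} [Category.{v} C]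

theorem res_idem [RestrictionCategory C] {X Y : C} (f : X ⟶ Y) : res f ≫ res f = res f := by
  rw [← res_res_comp, res_comp_self]

theorem res_comp_res [RestrictionCategory C] {X Y Z : C} (f : X ⟶ Y) (h : Y ⟶ Z) :
    res f ≫ res (f ≫ h) = res (f ≫ h) := by
  rw [← res_res_comp, ← Category.assoc, res_comp_self]

/-- The order on hom-sets: `f ≤ g` if and only if `g ∘ res f = f`. -/
instance [InverseCategory C] : HomOrder C where
  po X Y :=
    { le := fun f g => res f ≫ g = f
      le_refl := fun f => res_comp_self f
      le_trans := fun f g h hfg hgh => by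
        calc res f ≫ h = res (res f ≫ g) ≫ h := by rw [hfg]
          _ = res f ≫ (res g ≫ h) := by rw [res_res_comp, Category.assoc]
          _ = f := by rw [hgh, hfg]
      le_antisymm := fun f g hfg hgf => by
        calc f = res f ≫ g := hfg.symm
          _ = res f ≫ (res g ≫ f) := by rw [hgf]
          _ = res g ≫ (res f ≫ f) := by rw [← Category.assoc, res_comm, Category.assoc]
          _ = g := by rw [res_comp_self, hgf] }

variable [InverseCategory C]

theorem le_def {X Y : C} {f g : X ⟶ Y} : f ≤ g ↔ res f ≫ g = f := Iff.rfl

theorem comp_pinv {X Y : C} (f : X ⟶ Y) : f ≫ pinv f = res f :=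
  (InverseCategory.existsUnique_pinv f).choose_spec.1.1

theorem pinv_comp {X Y : C} (f : X ⟶ Y) : pinv f ≫ f = res (pinv f) :=
  (InverseCategory.existsUnique_pinv f).choose_spec.1.2

theorem eq_pinv {X Y : C} {f : X ⟶ Y} {g : Y ⟶ X} (h₁ : f ≫ g = res f) (h₂ : g ≫ f = res g) :
    g = pinv f :=
  (InverseCategory.existsUnique_pinv f).choose_spec.2 g ⟨h₁, h₂⟩

theorem pinv_pinv {X Y : C} (f : X ⟶ Y) : pinv (pinv f) = f :=
  (eq_pinv (pinv_comp f) (comp_pinv f)).symm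

theorem total_of_comp_eq_id {X Y : C} {f : X ⟶ Y} {g : Y ⟶ X} (h : f ≫ g = 𝟙 X) : Total f := by
  calc res f = res f ≫ (f ≫ g) := by rw [h, Category.comp_id]
    _ = 𝟙 X := by rw [← Category.assoc, res_comp_self, h]

theorem res_le_id {X Y : C} (f : X ⟶ Y) : res f ≤ 𝟙 X := by
  have h : res f = res (res f) := by
    have h₁ : res (res f ≫ f) = res f ≫ res f := res_res_comp f f
    have h₂ : res (res f ≫ 𝟙 X) = res f ≫ res (𝟙 X) := res_res_comp (𝟙 X) f
    have h₃ : Total (𝟙 X) := total_of_comp_eq_id (Category.comp_id _)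
    rw [Category.comp_id, h₃, Category.comp_id] at h₂
    exact h₂.symm
  rw [le_def, Category.comp_id, ← h]

theorem comp_le_comp {X Y Z : C} {f f' : X ⟶ Y} {g g' : Y ⟶ Z} (hf : f ≤ f') (hg : g ≤ g') :
    f ≫ g ≤ f' ≫ g' := by
  rw [le_def] at *
  have h : res (f ≫ g) ≫ f = f ≫ res g := (comp_res f g).symm
  have h' : res (f ≫ g) = res (f ≫ g) ≫ res f := by
    rw [res_comm, res_comp_res]
  calc res (f ≫ g) ≫ f' ≫ g' = res (f ≫ g) ≫ (res f ≫ f') ≫ g' := by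
        rw [h']; simp only [Category.assoc]; rw [← Category.assoc (res f) (res f), res_idem]
    _ = (res (f ≫ g) ≫ f) ≫ g' := by rw [hf, Category.assoc]
    _ = f ≫ g := by rw [h, Category.assoc, hg]

theorem pinv_comp_rev {X Y Z : C} (f : X ⟶ Y) (g : Y ⟶ Z) :
    pinv (f ≫ g) = pinv g ≫ pinv f := by
  symm
  apply eq_pinv
  · calc (f ≫ g) ≫ pinv g ≫ pinv f = f ≫ (g ≫ pinv g) ≫ pinv f := by simp
      _ = (f ≫ res g) ≫ pinv f := by rw [comp_pinv, Category.assoc]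
      _ = res (f ≫ g) ≫ res f := by rw [comp_res, Category.assoc, comp_pinv]
      _ = res (f ≫ g) := by rw [res_comm, res_comp_res]
  · calc (pinv g ≫ pinv f) ≫ f ≫ g = pinv g ≫ (pinv f ≫ f) ≫ g := by simp
      _ = (pinv g ≫ res (pinv f)) ≫ g := by rw [pinv_comp, Category.assoc]
      _ = res (pinv g ≫ pinv f) ≫ res (pinv g) := by rw [comp_res, Category.assoc, pinv_comp]
      _ = res (pinv g ≫ pinv f) := by rw [res_comm, res_comp_res]

theorem pinv_mono {X Y : C} {f g : X ⟶ Y} (h : f ≤ g) : pinv f ≤ pinv g := by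
  rw [le_def] at h
  have hr : res f ≫ res g = res f := by rw [← res_res_comp, h]
  have h₁ : pinv g ≫ f = res (pinv g ≫ f) := by
    calc pinv g ≫ f = (pinv g ≫ res f) ≫ g := by rw [Category.assoc, h]
      _ = res (pinv g ≫ f) ≫ res (pinv g) := by rw [comp_res, Category.assoc, pinv_comp]
      _ = res (pinv g ≫ f) := by rw [res_comm, res_comp_res]
  have h₂ : res (pinv g ≫ res f) = res (pinv g ≫ f) := by
    rw [comp_res, res_res_comp, res_comm, res_comp_res]
  have h₃ : pinv g ≫ res f = pinv f := by
    apply eq_pinv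
    · calc f ≫ pinv g ≫ res f = res f ≫ (g ≫ pinv g) ≫ res f := by
            rw [Category.assoc, ← Category.assoc, ← Category.assoc, h, Category.assoc]
        _ = (res f ≫ res g) ≫ res f := by rw [comp_pinv, Category.assoc]
        _ = res f := by rw [hr, res_idem]
    · rw [h₂, Category.assoc, res_comp_self]; exact h₁
  rw [le_def, ← h₃, h₂, comp_res]

theorem inverseCompatible_of_le {X Y : C} {f g h : X ⟶ Y} (hf : f ≤ h) (hg : g ≤ h) :
    InverseCompatible f g := by
  have key : ∀ {X Y : C} {f g h : X ⟶ Y}, f ≤ h → g ≤ h → RestrictionCompatible f g := by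
    intro X Y f g h hf hg
    rw [le_def] at hf hg
    unfold RestrictionCompatible
    calc res g ≫ f = (res g ≫ res f) ≫ h := by rw [Category.assoc, hf]
      _ = res f ≫ g := by rw [res_comm, Category.assoc, hg]
  exact ⟨key hf hg, key (pinv_mono hf) (pinv_mono hg)⟩

theorem compatibleSet_of_directedOn {X Y : C} {S : Set (X ⟶ Y)} (hS : DirectedOn (· ≤ ·) S) :
    CompatibleSet S := fun f hf g hg =>
  let ⟨_, _, h₁, h₂⟩ := hS f hf g hg
  inverseCompatible_of_le h₁ h₂

end Inverse

/-- A join inverse category: an inverse category in which every inverse compatible set `S` of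
parallel morphisms has a join, compatible with restriction and composition. The value of `join S`
carries no information when `S` is not inverse compatible. -/
class JoinInverseCategory (C : Type u) [Category.{v} C] extends InverseCategory C where
  join : ∀ {X Y : C}, Set (X ⟶ Y) → (X ⟶ Y)
  le_join : ∀ {X Y : C} {S : Set (X ⟶ Y)}, CompatibleSet S → ∀ s ∈ S, s ≤ join S
  join_le : ∀ {X Y : C} {S : Set (X ⟶ Y)}, CompatibleSet S →
    ∀ t : X ⟶ Y, (∀ s ∈ S, s ≤ t) → join S ≤ t
  res_join : ∀ {X Y : C} {S : Set (X ⟶ Y)}, CompatibleSet S →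
    res (join S) = join ((fun s => res s) '' S)
  join_comp : ∀ {X Y Z : C} {S : Set (X ⟶ Y)}, CompatibleSet S →
    ∀ f : Y ⟶ Z, join S ≫ f = join ((fun s => s ≫ f) '' S)
  comp_join : ∀ {W X Y : C} {S : Set (X ⟶ Y)}, CompatibleSet S →
    ∀ g : W ⟶ X, g ≫ join S = join ((fun s => g ≫ s) '' S)

open JoinInverseCategory

section Join

variable {C : Type u} [Category.{v} C] [JoinInverseCategory C]

/-- The hom-sets of a join inverse category are pointed dcpos. -/
instance (X Y : C) : CompletePartialOrder (X ⟶ Y) :=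
  { HomOrder.po X Y with
    sSup := join
    bot := join ∅
    bot_le := fun f => join_le (fun _ h => h.elim) f (fun _ h => h.elim)
    lubOfDirected := fun _ hS =>
      ⟨fun s hs => le_join (compatibleSet_of_directedOn hS) s hs,
        fun t ht => join_le (compatibleSet_of_directedOn hS) t ht⟩ }

/-- The zero morphism, that is, the empty join. -/
def zeroHom (X Y : C) : X ⟶ Y := join ∅

theorem eq_join {X Y : C} {S : Set (X ⟶ Y)} (hS : CompatibleSet S) {f : X ⟶ Y}
    (hf : IsLUB S f) : f = join S :=
  hf.unique ⟨fun s hs => le_join hS s hs, fun t ht => join_le hS t ht⟩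

/-- A monotone map that preserves the joins of nonempty compatible sets is Scott continuous. -/
theorem scott_of_join {X Y X' Y' : C} {φ : (X ⟶ Y) → (X' ⟶ Y')} (hm : Monotone φ)
    (hj : ∀ S : Set (X ⟶ Y), S.Nonempty → CompatibleSet S → φ (join S) = join (φ '' S)) :
    ScottContinuous φ := by
  intro S hne hS f hf
  have hc := compatibleSet_of_directedOn hS
  have hd : DirectedOn (· ≤ ·) (φ '' S) := by
    rintro _ ⟨a, ha, rfl⟩ _ ⟨b, hb, rfl⟩
    obtain ⟨c, hc, h₁, h₂⟩ := hS a ha b hb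
    exact ⟨φ c, ⟨c, hc, rfl⟩, hm h₁, hm h₂⟩
  rw [eq_join hc hf, hj S hne hc]
  exact hd.isLUB_sSup

theorem scott_comp {X Y Z : C} :
    ScottContinuous (fun p : (X ⟶ Y) × (Y ⟶ Z) => p.1 ≫ p.2) := by
  apply ScottContinuous.fromProd
  · intro f
    exact scott_of_join (fun _ _ h => comp_le_comp le_rfl h) (fun S _ hS => comp_join hS f)
  · intro g
    exact scott_of_join (fun _ _ h => comp_le_comp h le_rfl) (fun S _ hS => join_comp hS g)

theorem scott_pinv {X Y : C} : ScottContinuous (fun f : X ⟶ Y => pinv f) := by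
  intro _ _ _ f hf
  refine ⟨?_, fun t ht => ?_⟩
  · rintro _ ⟨s, hs, rfl⟩
    exact pinv_mono (hf.1 hs)
  · have : f ≤ pinv t := hf.2 fun s hs => by
      have := pinv_mono (ht ⟨s, hs, rfl⟩)
      rwa [pinv_pinv] at this
    have := pinv_mono this
    rwa [pinv_pinv] at this

end Join

end RevIso

namespace RevIso

open RestrictionCategory JoinInverseCategory

/-! ### Join inverse rig categories -/

/-- `Z` is a restriction zero: for all `X`, `Y` exactly one morphism `X ⟶ Y` factors through `Z`,
and its restriction is the corresponding endomorphism of `X`. -/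
def IsRestrictionZero {C : Type u} [Category.{v} C] [RestrictionCategory C] (Z : C) : Prop :=
  ∃ z : ∀ X Y : C, X ⟶ Y, ∀ X Y : C,
    (∃ (f : X ⟶ Z) (g : Z ⟶ Y), f ≫ g = z X Y) ∧
    (∀ (f : X ⟶ Z) (g : Z ⟶ Y), f ≫ g = z X Y) ∧
    res (z X Y) = z X X

/-- The monoidal product given by `M` is a join preserving restriction bifunctor: it preserves
restrictions, and nonempty joins in each of its two arguments. -/
structure JoinPreserving {C : Type u} [Category.{v} C] [JoinInverseCategory C]
    (M : MonoidalCategory C) : Prop where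
  tensor_res : ∀ {X Y X' Y' : C} (f : X ⟶ Y) (g : X' ⟶ Y'),
    res (M.tensorHom f g) = M.tensorHom (res f) (res g)
  tensor_join : ∀ {X Y X' Y' : C} (f : X ⟶ Y) (S : Set (X' ⟶ Y')), S.Nonempty →
    CompatibleSet S → M.tensorHom f (join S) = join ((fun s => M.tensorHom f s) '' S)
  join_tensor : ∀ {X Y X' Y' : C} (S : Set (X ⟶ Y)) (g : X' ⟶ Y'), S.Nonempty →
    CompatibleSet S → M.tensorHom (join S) g = join ((fun s => M.tensorHom s g) '' S)

/-- A join preserving disjointness tensor `(⊕, 0)` on a join inverse category. -/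
class DisjointnessTensor (C : Type u) [Category.{v} C] [JoinInverseCategory C] where
  plus : MonoidalCategory C
  plusSymmetric : @SymmetricCategory C _ plus
  plus_joinPreserving : JoinPreserving plus
  isRestrictionZero : IsRestrictionZero plus.tensorUnit
  inl : ∀ X Y : C, X ⟶ plus.tensorObj X Y
  inr : ∀ X Y : C, Y ⟶ plus.tensorObj X Y
  inl_total : ∀ X Y : C, Total (inl X Y)
  inr_total : ∀ X Y : C, Total (inr X Y)
  jointly_epic : ∀ {X Y Z : C} (f g : plus.tensorObj X Y ⟶ Z),
    inl X Y ≫ f = inl X Y ≫ g → inr X Y ≫ f = inr X Y ≫ g → f = g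
  jointly_monic : ∀ {X Y Z : C} (f g : Z ⟶ plus.tensorObj X Y),
    f ≫ pinv (inl X Y) = g ≫ pinv (inl X Y) → f ≫ pinv (inr X Y) = g ≫ pinv (inr X Y) → f = g
  disjoint : ∀ X Y : C, res (pinv (inr X Y)) ≫ res (pinv (inl X Y)) = zeroHom _ _

section

variable (C : Type u) [Category.{v} C] [JoinInverseCategory C] [DisjointnessTensor C]

/-- The unit `0` of the disjointness tensor. -/
def zeroObj : C := (DisjointnessTensor.plus (C := C)).tensorUnit

variable {C}

/-- The disjointness tensor on objects. -/
def osum (X Y : C) : C := (DisjointnessTensor.plus (C := C)).tensorObj X Y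

/-- The disjointness tensor on morphisms. -/
def osumHom {X Y X' Y' : C} (f : X ⟶ Y) (g : X' ⟶ Y') : osum X X' ⟶ osum Y Y' :=
  (DisjointnessTensor.plus (C := C)).tensorHom f g

/-- The left injection. -/
def injl (X Y : C) : X ⟶ osum X Y := DisjointnessTensor.inl X Y

/-- The right injection. -/
def injr (X Y : C) : Y ⟶ osum X Y := DisjointnessTensor.inr X Y

end

/-- A join inverse rig category: a join inverse category with a join preserving symmetric monoidal
product `(⊗, 1)`, a join preserving disjointness tensor `(⊕, 0)`, and isomorphisms
`A ⊗ (B ⊕ D) ≅ (A ⊗ B) ⊕ (A ⊗ D)` and `A ⊗ 0 ≅ 0`. -/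
class JoinInverseRigCategory (C : Type u) [Category.{v} C] [M : MonoidalCategory C]
    [SymmetricCategory C] [JoinInverseCategory C] [DisjointnessTensor C] : Prop where
  tensor_joinPreserving : JoinPreserving M
  distrib : ∀ A B D : C, Nonempty (A ⊗ osum B D ≅ osum (A ⊗ B) (A ⊗ D))
  annihil : ∀ A : C, Nonempty (A ⊗ zeroObj C ≅ zeroObj C)

/-- An embedding: the first component of an embedding-projection pair. -/
def IsEmbedding {C : Type u} [Category.{v} C] [HomOrder C] {X Y : C} (e : X ⟶ Y) : Prop :=
  ∃ p : Y ⟶ X, e ≫ p = 𝟙 X ∧ p ≫ e ≤ 𝟙 Y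

/-- The category has colimits of `ω`-chains of embeddings. -/
class HasEmbeddingColimits (C : Type u) [Category.{v} C] [HomOrder C] : Prop where
  hasColimit : ∀ F : ℕ ⥤ C, (∀ {m n : ℕ} (f : m ⟶ n), IsEmbedding (F.map f)) →
    Limits.HasColimit F

section

variable {C : Type u} [Category.{v} C] [JoinInverseCategory C]

theorem scott_tensor_aux {M : MonoidalCategory C} (hM : JoinPreserving M) {X Y X' Y' : C} :
    ScottContinuous (fun p : (X ⟶ Y) × (X' ⟶ Y') => M.tensorHom p.1 p.2) := by
  have mono : ∀ {f f' : X ⟶ Y} {g g' : X' ⟶ Y'}, f ≤ f' → g ≤ g' →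
      M.tensorHom f g ≤ M.tensorHom f' g' := by
    intro f f' g g' hf hg
    rw [le_def] at *
    rw [hM.tensor_res, MonoidalCategory.tensorHom_comp_tensorHom, hf, hg]
  apply ScottContinuous.fromProd
  · intro f
    exact scott_of_join (fun _ _ h => mono le_rfl h) (fun S hne hS => hM.tensor_join f S hne hS)
  · intro g
    exact scott_of_join (fun _ _ h => mono h le_rfl) (fun S hne hS => hM.join_tensor S g hne hS)

theorem scott_osumHom [DisjointnessTensor C] {X Y X' Y' : C} :
    ScottContinuous (fun p : (X ⟶ Y) × (X' ⟶ Y') => osumHom p.1 p.2) :=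
  scott_tensor_aux DisjointnessTensor.plus_joinPreserving

theorem scott_tensorHom [MonoidalCategory C] [SymmetricCategory C] [DisjointnessTensor C]
    [JoinInverseRigCategory C] {X Y X' Y' : C} :
    ScottContinuous (fun p : (X ⟶ Y) × (X' ⟶ Y') => p.1 ⊗ₘ p.2) :=
  scott_tensor_aux JoinInverseRigCategory.tensor_joinPreserving

end

/-! ### Scott continuous maps -/

/-- Scott continuous maps between partial orders. -/
@[ext]
structure ScottHom (α β : Type v) [PartialOrder α] [PartialOrder β] where
  toFun : α → β
  scott : ScottContinuous toFun

namespace ScottHom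

variable {α β γ : Type v}

instance [PartialOrder α] [PartialOrder β] : CoeFun (ScottHom α β) (fun _ => α → β) := ⟨toFun⟩

instance [PartialOrder α] [PartialOrder β] : PartialOrder (ScottHom α β) :=
  PartialOrder.lift toFun (fun _ _ h => ScottHom.ext h)

theorem monotone_apply [PartialOrder α] [PartialOrder β] (x : α) :
    Monotone (fun f : ScottHom α β => f x) := fun _ _ h => h x

theorem directedOn_apply [PartialOrder α] [PartialOrder β] {S : Set (ScottHom α β)}
    (hS : DirectedOn (· ≤ ·) S) (x : α) : DirectedOn (· ≤ ·) ((fun f => f x) '' S) := by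
  rintro _ ⟨a, ha, rfl⟩ _ ⟨b, hb, rfl⟩
  obtain ⟨c, hc, h₁, h₂⟩ := hS a ha b hb
  exact ⟨c x, ⟨c, hc, rfl⟩, h₁ x, h₂ x⟩

/-- Pointwise joins of directed sets of Scott continuous maps are Scott continuous. -/
theorem scott_sSup [PartialOrder α] [CompletePartialOrder β] {S : Set (ScottHom α β)}
    (hS : DirectedOn (· ≤ ·) S) :
    ScottContinuous (fun x => sSup ((fun f : ScottHom α β => f x) '' S)) := by
  intro d hne hd a ha
  refine ⟨?_, fun t ht => ?_⟩
  · rintro _ ⟨x, hx, rfl⟩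
    refine (directedOn_apply hS x).sSup_le ?_
    rintro _ ⟨f, hf, rfl⟩
    exact (f.scott.monotone (ha.1 hx)).trans ((directedOn_apply hS a).le_sSup ⟨f, hf, rfl⟩)
  · refine (directedOn_apply hS a).sSup_le ?_
    rintro _ ⟨f, hf, rfl⟩
    refine (f.scott hne hd ha).2 ?_
    rintro _ ⟨x, hx, rfl⟩
    exact ((directedOn_apply hS x).le_sSup ⟨f, hf, rfl⟩).trans (ht ⟨x, hx, rfl⟩)

/-- The pointed dcpo of Scott continuous maps. Joins of directed sets are pointwise; `sSup` of a set
that is not directed carries no information. -/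
noncomputable instance [PartialOrder α] [CompletePartialOrder β] :
    CompletePartialOrder (ScottHom α β) :=
  { (inferInstance : PartialOrder (ScottHom α β)) with
    sSup := fun S => open Classical in
      if hS : DirectedOn (· ≤ ·) S then
        ⟨fun x => sSup ((fun f : ScottHom α β => f x) '' S), scott_sSup hS⟩
      else ⟨fun _ => ⊥, ScottContinuous.const ⊥⟩
    bot := ⟨fun _ => ⊥, ScottContinuous.const ⊥⟩
    bot_le := fun f x => (bot_le : ⊥ ≤ f x)
    lubOfDirected := fun S hS => by
      classical
      rw [dif_pos hS]
      exact ⟨fun f hf x => (directedOn_apply hS x).le_sSup ⟨f, hf, rfl⟩,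
        fun t ht x => (directedOn_apply hS x).sSup_le
          (by rintro _ ⟨f, hf, rfl⟩; exact ht hf x)⟩ }

/-- Composition. -/
def comp [PartialOrder α] [PartialOrder β] [PartialOrder γ] (g : ScottHom β γ)
    (f : ScottHom α β) : ScottHom α γ :=
  ⟨fun x => g (f x), ScottContinuous.comp f.scott g.scott⟩

/-- Pairing. -/
def pair [PartialOrder α] [PartialOrder β] [PartialOrder γ] (f : ScottHom α β)
    (g : ScottHom α γ) : ScottHom α (β × γ) :=
  ⟨fun x => (f x, g x), f.scott.prodMk g.scott⟩

/-- Constant maps. -/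
def const [PartialOrder α] [PartialOrder β] (b : β) : ScottHom α β :=
  ⟨fun _ => b, ScottContinuous.const b⟩

/-- The identity. -/
def id [PartialOrder α] : ScottHom α α := ⟨fun x => x, ScottContinuous.id⟩

/-- First projection. -/
def fst [PartialOrder α] [PartialOrder β] : ScottHom (α × β) α := ⟨Prod.fst, ScottContinuous.fst⟩

/-- Second projection. -/
def snd [PartialOrder α] [PartialOrder β] : ScottHom (α × β) β := ⟨Prod.snd, ScottContinuous.snd⟩

theorem scott_apply [PartialOrder α] [CompletePartialOrder β] (x : α) :
    ScottContinuous (fun f : ScottHom α β => f x) := by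
  intro S _ hS f hf
  have h : f = sSup S := hf.unique hS.isLUB_sSup
  have h' : (sSup S : ScottHom α β) x = sSup ((fun f : ScottHom α β => f x) '' S) := by
    have : (sSup S : ScottHom α β) =
        ⟨fun x => sSup ((fun f : ScottHom α β => f x) '' S), scott_sSup hS⟩ := dif_pos hS
    rw [this]
  rw [h]
  change IsLUB _ ((sSup S : ScottHom α β) x)
  rw [h']
  exact (directedOn_apply hS x).isLUB_sSup

/-- Evaluation. -/
def eval [PartialOrder α] [CompletePartialOrder β] : ScottHom (ScottHom α β × α) β :=
  ⟨fun p => p.1 p.2, ScottContinuous.fromProd (fun f => f.scott) scott_apply⟩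

/-- Currying. -/
def curry [PartialOrder α] [PartialOrder β] [PartialOrder γ] (f : ScottHom (α × β) γ) :
    ScottHom α (ScottHom β γ) :=
  ⟨fun x => ⟨fun y => f (x, y),
      ScottContinuous.comp ((ScottContinuous.const x).prodMk ScottContinuous.id) f.scott⟩, by
    intro d hne hd a ha
    have h : ∀ y, ScottContinuous (fun x => f (x, y)) := fun y =>
      ScottContinuous.comp (ScottContinuous.id.prodMk (ScottContinuous.const y)) f.scott
    refine ⟨?_, fun t ht y => ?_⟩
    · rintro _ ⟨x, hx, rfl⟩ y
      exact (h y).monotone (ha.1 hx)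
    · refine (h y hne hd ha).2 ?_
      rintro _ ⟨x, hx, rfl⟩
      exact ht ⟨x, hx, rfl⟩ y⟩

/-- The approximations of the parametrised least fixed point of `f`. -/
noncomputable def approx [PartialOrder α] [CompletePartialOrder β] (f : ScottHom (α × β) β) :
    ℕ → ScottHom α β
  | 0 => ⊥
  | n + 1 => comp f (pair id (approx f n))

/-- The parametrised least fixed point: `fix f x` is the least fixed point of `f (x, -)`. -/
noncomputable def fix [PartialOrder α] [CompletePartialOrder β] (f : ScottHom (α × β) β) :
    ScottHom α β :=
  sSup (Set.range (approx f))

end ScottHom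

/-- Pointed dcpos. -/
structure Dom : Type (v + 1) where
  carrier : Type v
  [cpo : CompletePartialOrder carrier]

attribute [instance] Dom.cpo

namespace Dom

noncomputable instance {α β : Type v} [CompletePartialOrder α] [CompletePartialOrder β] :
    CompletePartialOrder (α × β) :=
  { (inferInstance : PartialOrder (α × β)) with
    sSup := fun S => (sSup (Prod.fst '' S), sSup (Prod.snd '' S))
    bot := (⊥, ⊥)
    bot_le := fun _ => ⟨bot_le, bot_le⟩
    lubOfDirected := fun _ hS => isLUB_prod.2 ⟨hS.fst.isLUB_sSup, hS.snd.isLUB_sSup⟩ }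

end Dom

end RevIso

namespace RevIso

open RestrictionCategory JoinInverseCategory

/-! ### Dcpo-functors and parametrised initial algebras -/

instance {D : Type u} {E : Type u} [Category.{v} D] [Category.{v} E] [HomOrder D] [HomOrder E] :
    HomOrder (D × E) where
  po X Y := inferInstanceAs (PartialOrder ((X.1 ⟶ Y.1) × (X.2 ⟶ Y.2)))

instance {ι : Type} {D : Type u} [Category.{v} D] [HomOrder D] : HomOrder (ι → D) where
  po X Y := inferInstanceAs (PartialOrder (∀ i, X i ⟶ Y i))

/-- Dcpo-functors: functors that are Scott continuous on hom-sets. -/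
structure DcpoFunctor (D : Type u) (E : Type u) [Category.{v} D] [Category.{v} E] [HomOrder D]
    [HomOrder E] extends D ⥤ E where
  scott : ∀ X Y : D, ScottContinuous (fun f : X ⟶ Y => map f)

namespace DcpoFunctor

variable {A : Type u} {B : Type u} {D : Type u} [Category.{v} A] [Category.{v} B] [Category.{v} D]
  [HomOrder A] [HomOrder B] [HomOrder D]

theorem ext_functor {F G : DcpoFunctor A B} (h : F.toFunctor = G.toFunctor) : F = G := by
  cases F; cases G; cases h; rfl

/-- Constant functors. -/
def const (X : B) : DcpoFunctor A B :=
  ⟨(Functor.const A).obj X, fun _ _ => ScottContinuous.const _⟩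

/-- Composition of functors, in diagrammatic order. -/
def comp (F : DcpoFunctor A B) (G : DcpoFunctor B D) : DcpoFunctor A D :=
  ⟨F.toFunctor ⋙ G.toFunctor, fun X Y =>
    ScottContinuous.comp (f := fun f : X ⟶ Y => F.map f) (F.scott X Y) (G.scott _ _)⟩

/-- The identity functor. -/
def id : DcpoFunctor A A := ⟨𝟭 A, fun _ _ => ScottContinuous.id⟩

/-- The first projection. -/
def fst : DcpoFunctor (A × B) A :=
  ⟨CategoryTheory.Prod.fst A B, fun _ _ => ScottContinuous.fst⟩

/-- The second projection. -/
def snd : DcpoFunctor (A × B) B :=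
  ⟨CategoryTheory.Prod.snd A B, fun _ _ => ScottContinuous.snd⟩

/-- Pairing of functors. -/
def pair (F : DcpoFunctor A B) (G : DcpoFunctor A D) : DcpoFunctor A (B × D) :=
  ⟨F.toFunctor.prod' G.toFunctor, fun X Y => ScottContinuous.prodMk (F.scott X Y) (G.scott X Y)⟩

/-- The partial application `F(a, -)`. -/
def partialApp (F : DcpoFunctor (A × B) D) (a : A) : DcpoFunctor B D :=
  ⟨CategoryTheory.Prod.sectR a B ⋙ F.toFunctor, fun X Y =>
    ScottContinuous.comp (f := fun f : X ⟶ Y => ((𝟙 a, f) : (a, X) ⟶ (a, Y)))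
      (ScottContinuous.prodMk (ScottContinuous.const _) ScottContinuous.id) (F.scott _ _)⟩

end DcpoFunctor

section InitialAlgebra

variable {C : Type u} [Category.{v} C] [JoinInverseCategory C] [DisjointnessTensor C]

theorem zeroObj_src {X : C} (f g : zeroObj C ⟶ X) : f = g := by
  obtain ⟨z, hz⟩ := DisjointnessTensor.isRestrictionZero (C := C)
  have hf : 𝟙 (zeroObj C) ≫ f = z (zeroObj C) X := (hz (zeroObj C) X).2.1 (𝟙 _) f
  have hg : 𝟙 (zeroObj C) ≫ g = z (zeroObj C) X := (hz (zeroObj C) X).2.1 (𝟙 _) g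
  simp only [Category.id_comp] at hf hg
  exact hf.trans hg.symm

/-- The objects of the initial chain `0 ⟶ G 0 ⟶ G (G 0) ⟶ ⋯`. -/
def chainObj (G : DcpoFunctor C C) : ℕ → C
  | 0 => zeroObj C
  | n + 1 => G.obj (chainObj G n)

/-- The morphisms of the initial chain. -/
def chainMap (G : DcpoFunctor C C) : ∀ n, chainObj G n ⟶ chainObj G (n + 1)
  | 0 => zeroHom _ _
  | n + 1 => G.map (chainMap G n)

theorem isEmbedding_chainMap (G : DcpoFunctor C C) : ∀ n, IsEmbedding (chainMap G n)
  | 0 => ⟨zeroHom _ _, zeroObj_src _ _, by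
      have : zeroHom (chainObj G 1) (chainObj G 0) ≫ chainMap G 0 = zeroHom _ _ := by
        unfold zeroHom
        rw [join_comp (fun _ h => h.elim), Set.image_empty]
      rw [this]
      exact (bot_le : (⊥ : chainObj G 1 ⟶ chainObj G 1) ≤ _)⟩
  | n + 1 => by
      obtain ⟨p, h₁, h₂⟩ := isEmbedding_chainMap G n
      refine ⟨G.map p, ?_, ?_⟩
      · change G.map (chainMap G n) ≫ G.map p = 𝟙 _
        rw [← G.map_comp, h₁, G.map_id]
      · change G.map p ≫ G.map (chainMap G n) ≤ 𝟙 _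
        rw [← G.map_comp]
        refine ((G.scott _ _).monotone h₂).trans ?_
        rw [G.map_id]

theorem isEmbedding_comp {C : Type u} [Category.{v} C] [InverseCategory C] {X Y Z : C}
    {f : X ⟶ Y} {g : Y ⟶ Z} (hf : IsEmbedding f) (hg : IsEmbedding g) : IsEmbedding (f ≫ g) := by
  obtain ⟨p, h₁, h₂⟩ := hf
  obtain ⟨q, h₃, h₄⟩ := hg
  refine ⟨q ≫ p, ?_, ?_⟩
  · rw [Category.assoc, ← Category.assoc g, h₃, Category.id_comp, h₁]
  · refine le_trans (b := q ≫ g) ?_ h₄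
    rw [Category.assoc, ← Category.assoc p]
    refine comp_le_comp le_rfl ?_
    have := comp_le_comp h₂ (le_refl g)
    rwa [Category.id_comp] at this

theorem isEmbedding_of_succ {C : Type u} [Category.{v} C] [InverseCategory C] (F : ℕ ⥤ C)
    (hF : ∀ n, IsEmbedding (F.map (homOfLE (Nat.le_succ n)))) {m n : ℕ} (f : m ⟶ n) :
    IsEmbedding (F.map f) := by
  have key : ∀ k (h : m ≤ k), IsEmbedding (F.map (homOfLE h)) := by
    intro k h
    induction k, h using Nat.le_induction with
    | base =>
      have : homOfLE (le_refl m) = 𝟙 m := rfl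
      rw [this, F.map_id]
      exact ⟨𝟙 _, Category.comp_id _, by rw [Category.comp_id]⟩
    | succ k h ih =>
      have : homOfLE (h.trans (Nat.le_succ k)) = homOfLE h ≫ homOfLE (Nat.le_succ k) := rfl
      rw [this, F.map_comp]
      exact isEmbedding_comp ih (hF k)
  exact key n (leOfHom f)

/-- If a chain of embeddings starts at an initial object and its shift is its image under `G`, then
its colimit carries an initial `G`-algebra. -/
theorem exists_initialAlgebra_of_chain {C : Type u} [Category.{v} C] [JoinInverseCategory C]
    [HasEmbeddingColimits C] (G : DcpoFunctor C C) (F : ℕ ⥤ C)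
    (hF : ∀ {m n : ℕ} (f : m ⟶ n), IsEmbedding (F.map f))
    (h0 : ∀ {X : C} (f g : F.obj 0 ⟶ X), f = g) (w : ∀ n, G.obj (F.obj n) ≅ F.obj (n + 1))
    (hw : ∀ n, G.map (F.map (homOfLE (Nat.le_succ n))) ≫ (w (n + 1)).hom =
      (w n).hom ≫ F.map (homOfLE (Nat.le_succ (n + 1)))) :
    ∃ I : Endofunctor.Algebra G.toFunctor, Nonempty (Limits.IsInitial I) := by
  have : Limits.HasColimit F := HasEmbeddingColimits.hasColimit _ hF
  have hw' : ∀ n, F.map (homOfLE (Nat.le_succ (n + 1))) ≫ (w (n + 1)).inv =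
      (w n).inv ≫ G.map (F.map (homOfLE (Nat.le_succ n))) := fun n => by
    rw [Iso.comp_inv_eq, Category.assoc, hw, Iso.inv_hom_id_assoc]
  have htF : ∀ {m n : ℕ} (f : m ⟶ n), res (F.map f) = 𝟙 _ := fun f =>
    let ⟨_, h, _⟩ := hF f
    total_of_comp_eq_id h
  let L := Limits.colimit F
  let c : ∀ n, F.obj n ⟶ L := fun n => Limits.colimit.ι F n
  have hc : ∀ n, F.map (homOfLE (Nat.le_succ n)) ≫ c (n + 1) = c n := fun n =>
    Limits.colimit.w F _
  have hext : ∀ {Y : C} {f g : L ⟶ Y}, (∀ n, c n ≫ f = c n ≫ g) → f = g := fun h =>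
    Limits.colimit.hom_ext h
  have hdesc : ∀ {Y : C} (h : ∀ n, F.obj n ⟶ Y),
      (∀ n, F.map (homOfLE (Nat.le_succ n)) ≫ h (n + 1) = h n) →
      ∃ d : L ⟶ Y, ∀ n, c n ≫ d = h n := fun {Y} h hh =>
    let s : Limits.Cocone F :=
      ⟨Y, NatTrans.ofSequence (F := F) (G := (Functor.const ℕ).obj Y) h (fun n => by
        rw [hh n]; exact (Category.comp_id _).symm)⟩
    ⟨Limits.colimit.desc F s, fun n => Limits.colimit.ι_desc s n⟩
  -- the colimit injections are total
  have htot : ∀ m, c m ≫ pinv (c m) = 𝟙 _ := by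
    intro m
    obtain ⟨d, hd⟩ := hdesc (Y := F.obj m)
      (fun n => F.map (homOfLE (le_max_left n m)) ≫
        pinv (F.map (homOfLE (le_max_right n m)))) (by
        intro n
        let t := F.map (homOfLE (max_le_max (Nat.le_succ n) (le_refl m)))
        have h₁ : F.map (homOfLE (Nat.le_succ n)) ≫ F.map (homOfLE (le_max_left (n + 1) m)) =
            F.map (homOfLE (le_max_left n m)) ≫ t := by
          rw [← F.map_comp, ← F.map_comp]; rfl
        have h₂ : F.map (homOfLE (le_max_right (n + 1) m)) =
            F.map (homOfLE (le_max_right n m)) ≫ t := by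
          rw [← F.map_comp]; rfl
        rw [← Category.assoc, h₁, h₂, pinv_comp_rev, Category.assoc, ← Category.assoc t,
          comp_pinv, htF, Category.id_comp])
    have := hd m
    rw [show F.map (homOfLE (le_max_left m m)) =
      F.map (homOfLE (le_max_right m m)) from rfl, comp_pinv, htF] at this
    rw [comp_pinv]
    exact total_of_comp_eq_id this
  -- the idempotents of the injections form a chain with join the identity
  have hmono : Monotone (fun n => pinv (c n) ≫ c n) := by
    apply monotone_nat_of_le_succ
    intro n
    rw [← hc n, pinv_comp_rev, Category.assoc]
    refine comp_le_comp le_rfl ?_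
    rw [← Category.assoc, pinv_comp]
    have := comp_le_comp (res_le_id (pinv (F.map (homOfLE (Nat.le_succ n))))) (le_refl (c (n + 1)))
    rwa [Category.id_comp] at this
  have hle : ∀ n, pinv (c n) ≫ c n ≤ 𝟙 L := fun n => by rw [pinv_comp]; exact res_le_id _
  have hdir : DirectedOn (· ≤ ·) (Set.range fun n => pinv (c n) ≫ c n) :=
    hmono.directed_le.directedOn_range
  have hlub : IsLUB (Set.range fun n => pinv (c n) ≫ c n) (𝟙 L) := by
    have h := hdir.isLUB_sSup
    have : sSup (Set.range fun n => pinv (c n) ≫ c n) = 𝟙 L := by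
      apply hext
      intro n
      apply le_antisymm
      · exact comp_le_comp le_rfl (h.2 (by rintro _ ⟨m, rfl⟩; exact hle m))
      · have := comp_le_comp (le_refl (c n)) (h.1 ⟨n, rfl⟩)
        rw [← Category.assoc, htot, Category.id_comp] at this
        rwa [Category.comp_id]
    rwa [this] at h
  -- the images of the injections under `G` are jointly epic
  have hGext : ∀ {Y : C} {f g : G.obj L ⟶ Y},
      (∀ n, G.map (c n) ≫ f = G.map (c n) ≫ g) → f = g := by
    intro Y f g h
    have h₁ := G.scott L L (Set.range_nonempty _) hdir hlub
    have h₂ : ∀ k : G.obj L ⟶ Y, IsLUB ((fun s => s ≫ k) ''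
        ((fun f => G.map f) '' Set.range fun n => pinv (c n) ≫ c n)) (G.map (𝟙 L) ≫ k) := by
      intro k
      refine (ScottContinuous.comp (f := fun s => (s, k))
        (ScottContinuous.prodMk ScottContinuous.id (ScottContinuous.const k)) scott_comp)
        ((Set.range_nonempty _).image _) ?_ h₁
      rintro _ ⟨a, ha, rfl⟩ _ ⟨b, hb, rfl⟩
      obtain ⟨e, he, h₃, h₄⟩ := hdir a ha b hb
      exact ⟨_, ⟨e, he, rfl⟩, (G.scott L L).monotone h₃, (G.scott L L).monotone h₄⟩
    have h₃ : (fun s => s ≫ f) '' ((fun f => G.map f) '' Set.range fun n => pinv (c n) ≫ c n) =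
        (fun s => s ≫ g) '' ((fun f => G.map f) '' Set.range fun n => pinv (c n) ≫ c n) := by
      apply Set.image_congr
      rintro _ ⟨_, ⟨n, rfl⟩, rfl⟩
      change G.map _ ≫ f = G.map _ ≫ g
      rw [G.map_comp, Category.assoc, Category.assoc, h]
    have h₄ := h₂ f
    rw [h₃] at h₄
    have h₅ := h₄.unique (h₂ g)
    rwa [G.map_id, Category.id_comp, Category.id_comp] at h₅
  -- the structure morphism is the partial inverse of the comparison morphism `b`
  obtain ⟨b, hb⟩ := hdesc (Y := G.obj L)
    (fun n => match n with
      | 0 => zeroHom _ _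
      | n + 1 => (w n).inv ≫ G.map (c n)) (by
      intro n
      match n with
      | 0 => exact h0 _ _
      | n + 1 =>
        change F.map (homOfLE (Nat.le_succ (n + 1))) ≫ (w (n + 1)).inv ≫ G.map (c (n + 1)) =
          (w n).inv ≫ G.map (c n)
        rw [← Category.assoc, hw', Category.assoc, ← G.map_comp, hc])
  have hbs : ∀ n, (w n).hom ≫ c (n + 1) ≫ b = G.map (c n) := fun n => by
    rw [hb (n + 1)]; exact (w n).hom_inv_id_assoc _
  have hbtot : res b = 𝟙 L := by
    have h : ∀ n, c (n + 1) ≫ res b = c (n + 1) := fun n => by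
      have ht : Total (c (n + 1) ≫ b) := by
        apply total_of_comp_eq_id (g := G.map (pinv (c n)) ≫ (w n).hom)
        rw [hb (n + 1)]
        change ((w n).inv ≫ G.map (c n)) ≫ G.map (pinv (c n)) ≫ (w n).hom = _
        rw [Category.assoc, ← Category.assoc (G.map (c n)), ← G.map_comp, htot, G.map_id,
          Category.id_comp, Iso.inv_hom_id]
      rw [comp_res, ht, Category.id_comp]
    apply hext
    intro n
    rw [← hc n, Category.assoc, h, Category.comp_id]
  have hα : ∀ n, G.map (c n) ≫ pinv b = (w n).hom ≫ c (n + 1) := fun n => by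
    rw [← hbs, Category.assoc, Category.assoc, comp_pinv, hbtot, Category.comp_id]
  let h : ∀ (A : Endofunctor.Algebra G.toFunctor) (n : ℕ), F.obj n ⟶ A.a := fun A n =>
    Nat.rec (motive := fun n => F.obj n ⟶ A.a) (zeroHom _ _)
      (fun n k => (w n).inv ≫ G.map k ≫ A.str) n
  have hh : ∀ A n, F.map (homOfLE (Nat.le_succ n)) ≫ h A (n + 1) = h A n := by
    intro A n
    induction n with
    | zero => exact h0 _ _
    | succ n ih =>
      change F.map (homOfLE (Nat.le_succ (n + 1))) ≫ (w (n + 1)).inv ≫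
        G.map (h A (n + 1)) ≫ A.str = (w n).inv ≫ G.map (h A n) ≫ A.str
      rw [← Category.assoc, hw', Category.assoc, ← Category.assoc (G.map _), ← G.map_comp, ih]
  let I : Endofunctor.Algebra G.toFunctor := ⟨L, pinv b⟩
  have hex : ∀ A, ∃ k : I ⟶ A, ∀ n, c n ≫ k.f = h A n := by
    intro A
    obtain ⟨d, hd⟩ := hdesc (h A) (hh A)
    refine ⟨⟨d, ?_⟩, hd⟩
    apply hGext
    intro n
    change G.map (c n) ≫ G.map d ≫ A.str = G.map (c n) ≫ pinv b ≫ d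
    rw [← Category.assoc, ← G.map_comp, hd, ← Category.assoc, hα, Category.assoc, hd]
    exact ((w n).hom_inv_id_assoc _).symm
  have huniq : ∀ A (k : I ⟶ A) n, c n ≫ k.f = h A n := by
    intro A k n
    have hk : G.map k.f ≫ A.str = pinv b ≫ k.f := k.h
    induction n with
    | zero => exact h0 _ _
    | succ n ih =>
      rw [← cancel_epi (w n).hom, ← Category.assoc, ← hα, Category.assoc, ← hk, ← Category.assoc,
        ← G.map_comp, ih]
      exact ((w n).hom_inv_id_assoc _).symm
  exact ⟨I, ⟨Limits.IsInitial.ofUniqueHom (fun A => (hex A).choose) fun A k =>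
    Endofunctor.Algebra.ext (hext fun n => by
      rw [huniq, huniq])⟩⟩

/-- Every dcpo-endofunctor has an initial algebra. -/
theorem exists_initialAlgebra [HasEmbeddingColimits C] (G : DcpoFunctor C C) :
    ∃ I : Endofunctor.Algebra G.toFunctor, Nonempty (Limits.IsInitial I) := by
  have hs : ∀ n, (Functor.ofSequence (chainMap G)).map (homOfLE (Nat.le_succ n)) = chainMap G n :=
    fun n => Functor.ofSequence_map_homOfLE_succ (chainMap G) n
  refine exists_initialAlgebra_of_chain G (Functor.ofSequence (chainMap G))
    (isEmbedding_of_succ _ fun n => ?_) zeroObj_src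
    (fun n => Iso.refl (chainObj G (n + 1))) (fun n => ?_)
  · rw [hs]; exact isEmbedding_chainMap G n
  · rw [hs, hs]
    exact (Category.comp_id _).trans (Category.id_comp (chainMap G (n + 1))).symm

/-- The chosen initial algebra of a dcpo-endofunctor. -/
noncomputable def initialAlgebra [HasEmbeddingColimits C] (G : DcpoFunctor C C) :
    Endofunctor.Algebra G.toFunctor :=
  (exists_initialAlgebra G).choose

/-- Initiality of the chosen initial algebra. -/
noncomputable def initialAlgebraIsInitial [HasEmbeddingColimits C] (G : DcpoFunctor C C) :
    Limits.IsInitial (initialAlgebra G) :=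
  (exists_initialAlgebra G).choose_spec.some

end InitialAlgebra

end RevIso

namespace RevIso

open RestrictionCategory JoinInverseCategory

section JointMap

variable {C : Type u} [Category.{v} C] [HomOrder C] {D : Type u} [Category.{v} D] [HomOrder D]

/-- The family of morphisms `F(d, X) ⟶ F(d', X)` induced by `f : d ⟶ d'`. -/
def paramMap (F : DcpoFunctor (D × C) C) {d d' : D} (f : d ⟶ d') (X : C) :
    (F.partialApp d).obj X ⟶ (F.partialApp d').obj X :=
  F.map ((f, 𝟙 X) : (d, X) ⟶ (d', X))

/-- The action of `F` on a pair of morphisms. -/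
def jointMap (F : DcpoFunctor (D × C) C) {d d' : D} {X X' : C} (f : d ⟶ d') (k : X ⟶ X') :
    (F.partialApp d).obj X ⟶ (F.partialApp d').obj X' :=
  F.map ((f, k) : (d, X) ⟶ (d', X'))

theorem jointMap_eq (F : DcpoFunctor (D × C) C) {d d' : D} {X X' : C} (f : d ⟶ d') (k : X ⟶ X') :
    jointMap F f k = (F.partialApp d).map k ≫ paramMap F f X' := by
  change F.map ((f, k) : (d, X) ⟶ (d', X')) =
    F.map ((𝟙 d, k) : (d, X) ⟶ (d, X')) ≫ F.map ((f, 𝟙 _) : (d, X') ⟶ (d', X'))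
  rw [← F.map_comp]
  congr 1
  exact Prod.ext (Category.id_comp f).symm (Category.comp_id k).symm

theorem jointMap_id (F : DcpoFunctor (D × C) C) (d : D) (X : C) :
    jointMap F (𝟙 d) (𝟙 X) = 𝟙 _ :=
  F.map_id (d, X)

theorem jointMap_comp (F : DcpoFunctor (D × C) C) {d₁ d₂ d₃ : D} {X₁ X₂ X₃ : C} (f : d₁ ⟶ d₂)
    (g : d₂ ⟶ d₃) (k : X₁ ⟶ X₂) (l : X₂ ⟶ X₃) :
    jointMap F (f ≫ g) (k ≫ l) = jointMap F f k ≫ jointMap F g l :=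
  F.map_comp ((f, k) : (d₁, X₁) ⟶ (d₂, X₂)) ((g, l) : (d₂, X₂) ⟶ (d₃, X₃))

theorem scott_jointMap (F : DcpoFunctor (D × C) C) (d d' : D) (X X' : C) :
    ScottContinuous (fun p : (d ⟶ d') × (X ⟶ X') => jointMap F p.1 p.2) :=
  F.scott (d, X) (d', X')

end JointMap

section Sharp

variable {C : Type u} [Category.{v} C] [JoinInverseCategory C] [DisjointnessTensor C]
  [HasEmbeddingColimits C]

/-- The morphism between the carriers of the initial algebras of `G` and `H` induced by a family
of morphisms `G X ⟶ H X`. -/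
noncomputable def initialMap (G H : DcpoFunctor C C) (τ : ∀ X : C, G.obj X ⟶ H.obj X) :
    (initialAlgebra G).a ⟶ (initialAlgebra H).a :=
  ((initialAlgebraIsInitial G).to ⟨(initialAlgebra H).a, τ _ ≫ (initialAlgebra H).str⟩).f

theorem initialMap_spec (G H : DcpoFunctor C C) (τ : ∀ X : C, G.obj X ⟶ H.obj X) :
    G.map (initialMap G H τ) ≫ τ _ ≫ (initialAlgebra H).str =
      (initialAlgebra G).str ≫ initialMap G H τ :=
  ((initialAlgebraIsInitial G).to ⟨(initialAlgebra H).a, τ _ ≫ (initialAlgebra H).str⟩).h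

theorem initialMap_unique (G H : DcpoFunctor C C) (τ : ∀ X : C, G.obj X ⟶ H.obj X)
    (k : (initialAlgebra G).a ⟶ (initialAlgebra H).a)
    (hk : G.map k ≫ τ _ ≫ (initialAlgebra H).str = (initialAlgebra G).str ≫ k) :
    k = initialMap G H τ :=
  congrArg Endofunctor.Algebra.Hom.f ((initialAlgebraIsInitial G).hom_ext
    (Y := ⟨(initialAlgebra H).a, τ _ ≫ (initialAlgebra H).str⟩) ⟨k, hk⟩
    ((initialAlgebraIsInitial G).to ⟨(initialAlgebra H).a, τ _ ≫ (initialAlgebra H).str⟩))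

variable {D : Type u} [Category.{v} D] [HomOrder D]

theorem paramMap_spec (F : DcpoFunctor (D × C) C) {d d' : D} (f : d ⟶ d')
    {k : (initialAlgebra (F.partialApp d)).a ⟶ (initialAlgebra (F.partialApp d')).a} :
    k = initialMap _ _ (paramMap F f) ↔
    jointMap F f k ≫ (initialAlgebra (F.partialApp d')).str =
      (initialAlgebra (F.partialApp d)).str ≫ k := by
  constructor
  · rintro rfl
    rw [jointMap_eq, Category.assoc, initialMap_spec]
  · intro hk
    apply initialMap_unique
    rw [← hk, jointMap_eq, Category.assoc]

theorem scott_initialMap (F : DcpoFunctor (D × C) C) (d d' : D) :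
    ScottContinuous (fun f : d ⟶ d' => initialMap _ _ (paramMap F f)) := by
  let I := initialAlgebra (F.partialApp d)
  let I' := initialAlgebra (F.partialApp d')
  let inv : I.a ⟶ (F.partialApp d).obj I.a :=
    Endofunctor.Algebra.Initial.strInv (initialAlgebraIsInitial (F.partialApp d))
  have hinv₁ : I.str ≫ inv = 𝟙 _ :=
    Endofunctor.Algebra.Initial.right_inv (initialAlgebraIsInitial (F.partialApp d))
  have hinv₂ : inv ≫ I.str = 𝟙 _ :=
    Endofunctor.Algebra.Initial.left_inv (initialAlgebraIsInitial (F.partialApp d))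
  let Φ : (d ⟶ d') × (I.a ⟶ I'.a) → (I.a ⟶ I'.a) := fun p =>
    inv ≫ jointMap F p.1 p.2 ≫ I'.str
  have hfix : ∀ f k, k = initialMap _ _ (paramMap F f) ↔ Φ (f, k) = k := by
    intro f k
    rw [paramMap_spec]
    constructor
    · intro h
      change inv ≫ jointMap F f k ≫ (initialAlgebra (F.partialApp d')).str = k
      rw [h, ← Category.assoc, hinv₂, Category.id_comp]
    · intro h
      change inv ≫ jointMap F f k ≫ I'.str = k at h
      have h' : I.str ≫ inv ≫ jointMap F f k ≫ I'.str = I.str ≫ k := by rw [h]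
      rw [← Category.assoc, hinv₁, Category.id_comp] at h'
      exact h'
  have hΦ : ScottContinuous Φ := by
    have h₁ : ScottContinuous (fun p : (d ⟶ d') × (I.a ⟶ I'.a) =>
        jointMap F p.1 p.2) := scott_jointMap F d d' I.a I'.a
    have h₂ : ScottContinuous (fun g : (F.partialApp d).obj I.a ⟶ (F.partialApp d').obj I'.a =>
        inv ≫ g ≫ I'.str) := by
      have h₃ : ScottContinuous (fun g : (F.partialApp d).obj I.a ⟶ (F.partialApp d').obj I'.a =>
          g ≫ I'.str) := ScottContinuous.comp (f := fun s => (s, I'.str))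
        (ScottContinuous.prodMk ScottContinuous.id (ScottContinuous.const _)) scott_comp
      have h₄ : ScottContinuous (fun g : (F.partialApp d).obj I.a ⟶ I'.a => inv ≫ g) :=
        ScottContinuous.comp (f := fun s => (inv, s))
        (ScottContinuous.prodMk (ScottContinuous.const _) ScottContinuous.id) scott_comp
      exact ScottContinuous.comp h₃ h₄
    exact ScottContinuous.comp
      (f := fun p : (d ⟶ d') × (I.a ⟶ I'.a) => jointMap F p.1 p.2) h₁ h₂
  have hmono : Monotone (fun f : d ⟶ d' => initialMap _ _ (paramMap F f)) := by
    intro f g hfg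
    let a := initialMap _ _ (paramMap F f)
    let b := initialMap _ _ (paramMap F g)
    have ha : Φ (f, a) = a := (hfix f a).1 rfl
    have hb : Φ (g, b) = b := (hfix g b).1 rfl
    let φ : (I.a ⟶ I'.a) →o (I.a ⟶ I'.a) := ⟨fun k => Φ (f, k), fun _ _ h =>
      hΦ.monotone (Prod.mk_le_mk.2 ⟨le_rfl, h⟩)⟩
    have hφ : OmegaCompletePartialOrder.ωScottContinuous φ :=
      (ScottContinuous.comp (f := fun k => (f, k))
        (ScottContinuous.prodMk (ScottContinuous.const _) ScottContinuous.id)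
        hΦ).ωScottContinuous
    let φ' : OmegaCompletePartialOrder.ContinuousHom (I.a ⟶ I'.a) (I.a ⟶ I'.a) :=
      ⟨φ, hφ.map_ωSup⟩
    have h₁ := OmegaCompletePartialOrder.fixedPoints.ωSup_iterate_mem_fixedPoint φ' ⊥ bot_le
    have h₂ := OmegaCompletePartialOrder.fixedPoints.ωSup_iterate_le_prefixedPoint φ' ⊥ bot_le
      (a := b) (by
        change Φ (f, b) ≤ b
        conv_rhs => rw [← hb]
        exact hΦ.monotone (Prod.mk_le_mk.2 ⟨hfg, le_rfl⟩)) bot_le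
    have h₃ := (hfix f _).2 h₁
    change a ≤ b
    rw [show a = _ from h₃.symm]
    exact h₂
  intro S hne hS f hf
  let M := fun f : d ⟶ d' => initialMap _ _ (paramMap F f)
  have hdir : DirectedOn (· ≤ ·) (M '' S) := by
    rintro _ ⟨a, ha, rfl⟩ _ ⟨b, hb, rfl⟩
    obtain ⟨e, he, h₁, h₂⟩ := hS a ha b hb
    exact ⟨M e, ⟨e, he, rfl⟩, hmono h₁, hmono h₂⟩
  have hlub := hdir.isLUB_sSup
  have hdir' : DirectedOn (· ≤ ·) ((fun f => (f, M f)) '' S) := by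
    rintro _ ⟨a, ha, rfl⟩ _ ⟨b, hb, rfl⟩
    obtain ⟨e, he, h₁, h₂⟩ := hS a ha b hb
    exact ⟨_, ⟨e, he, rfl⟩, ⟨h₁, hmono h₁⟩, ⟨h₂, hmono h₂⟩⟩
  have hpair : IsLUB ((fun f => (f, M f)) '' S) (f, sSup (M '' S)) := by
    rw [isLUB_prod, ← Set.image_comp, ← Set.image_comp]
    refine ⟨?_, hlub⟩
    have : (Prod.fst ∘ fun f => (f, M f)) '' S = S := Set.image_id S
    rw [this]
    exact hf
  have h := hΦ (hne.image _) hdir' hpair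
  have himg : Φ '' ((fun f => (f, M f)) '' S) = M '' S := by
    rw [← Set.image_comp]
    exact Set.image_congr fun s _ => (hfix s (M s)).1 rfl
  rw [himg] at h
  have := (hfix f _).2 (h.unique hlub)
  change IsLUB (M '' S) (initialMap _ _ (paramMap F f))
  rw [← this]
  exact hlub

/-- The parametrised initial algebra: `sharp F d` is the carrier of the chosen initial algebra of
`F(d, -)`, and `sharp F f` is induced by initiality. -/
noncomputable def sharp (F : DcpoFunctor (D × C) C) : DcpoFunctor D C where
  obj d := (initialAlgebra (F.partialApp d)).a
  map f := initialMap _ _ (paramMap F f)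
  map_id d := ((paramMap_spec F (𝟙 d)).2 (by
    rw [jointMap_id, Category.id_comp, Category.comp_id])).symm
  map_comp f g := ((paramMap_spec F (f ≫ g)).2 (by
    have h₁ := (paramMap_spec F f).1 rfl
    have h₂ := (paramMap_spec F g).1 rfl
    rw [jointMap_comp, Category.assoc, h₂, ← Category.assoc, h₁, Category.assoc])).symm
  scott d d' := scott_initialMap F d d'

theorem initialMap_congr {G G' H H' : DcpoFunctor C C} (hG : G = G') (hH : H = H')
    {τ : ∀ X : C, G.obj X ⟶ H.obj X} {τ' : ∀ X : C, G'.obj X ⟶ H'.obj X} (h : HEq τ τ') :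
    HEq (initialMap G H τ) (initialMap G' H' τ') := by
  subst hG hH
  rw [eq_of_heq h]

/-- Parametrised initial algebras commute with reindexing of the parameter. -/
theorem sharp_reindex {E : Type u} [Category.{v} E] [HomOrder E] (K : DcpoFunctor E D)
    (F : DcpoFunctor (D × C) C) :
    sharp (((DcpoFunctor.fst.comp K).pair DcpoFunctor.snd).comp F) = K.comp (sharp F) := by
  have hG : ∀ d, (((DcpoFunctor.fst.comp K).pair DcpoFunctor.snd).comp F).partialApp d =
      F.partialApp (K.obj d) := by
    intro d
    apply DcpoFunctor.ext_functor
    refine Functor.hext (fun _ => rfl) fun X Y f => heq_of_eq ?_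
    change F.map ((K.map (𝟙 d), f) : (K.obj d, X) ⟶ (K.obj d, Y)) = F.map (𝟙 (K.obj d), f)
    rw [K.map_id]
  apply DcpoFunctor.ext_functor
  refine Functor.hext (fun d => ?_) fun X Y f => ?_
  · change (initialAlgebra _).a = (initialAlgebra _).a
    rw [hG]
  · exact initialMap_congr (hG X) (hG Y) HEq.rfl

end Sharp

end RevIso

namespace RevIso

open RestrictionCategory JoinInverseCategory

/-! ### Types -/

/-- Base types with free type variables among `X₀, …, Xₙ₋₁` (de Bruijn indices; `mu` binds the
variable `0` of its argument). Closed types are the elements of `Ty 0`. -/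
inductive Ty : ℕ → Type
  | var {n : ℕ} (i : Fin n) : Ty n
  | one {n : ℕ} : Ty n
  | sum {n : ℕ} (A B : Ty n) : Ty n
  | tensor {n : ℕ} (A B : Ty n) : Ty n
  | mu {n : ℕ} (A : Ty (n + 1)) : Ty n

namespace Ty

/-- Extension of a renaming under a binder. -/
def liftRen {m n : ℕ} (r : Fin m → Fin n) : Fin (m + 1) → Fin (n + 1) :=
  Fin.cases 0 (fun i => (r i).succ)

/-- Renaming of type variables. -/
def rename : {m n : ℕ} → (Fin m → Fin n) → Ty m → Ty n
  | _, _, r, var i => var (r i)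
  | _, _, _, one => one
  | _, _, r, sum A B => sum (rename r A) (rename r B)
  | _, _, r, tensor A B => tensor (rename r A) (rename r B)
  | _, _, r, mu A => mu (rename (liftRen r) A)

/-- Extension of a substitution under a binder. -/
def liftSubst {m n : ℕ} (s : Fin m → Ty n) : Fin (m + 1) → Ty (n + 1) :=
  Fin.cases (var 0) (fun i => rename Fin.succ (s i))

/-- Substitution for type variables. -/
def subst : {m n : ℕ} → (Fin m → Ty n) → Ty m → Ty n
  | _, _, s, var i => s i
  | _, _, _, one => one
  | _, _, s, sum A B => sum (subst s A) (subst s B)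
  | _, _, s, tensor A B => tensor (subst s A) (subst s B)
  | _, _, s, mu A => mu (subst (liftSubst s) A)

/-- The unfolding `A[μX.A/X]` of `μX.A`. -/
def unfold (A : Ty 1) : Ty 0 := subst (fun _ => mu A) A

section Semantics

variable {C : Type u} [Category.{v} C] [M : MonoidalCategory C] [SymmetricCategory C]
  [JoinInverseCategory C] [DisjointnessTensor C] [JoinInverseRigCategory C]
  [HasEmbeddingColimits C]

/-- The monoidal product as a dcpo-functor. -/
def tensorFunctor : DcpoFunctor (C × C) C :=
  ⟨MonoidalCategory.tensor C, fun _ _ => scott_tensorHom⟩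

/-- The disjointness tensor as a dcpo-functor. -/
def osumFunctor : DcpoFunctor (C × C) C :=
  ⟨@MonoidalCategory.tensor C _ DisjointnessTensor.plus, fun _ _ => scott_osumHom⟩

/-- Extension of an environment by the last projection. -/
def liftEnv {D : Type u} [Category.{v} D] [HomOrder D] {n : ℕ} (ρ : Fin n → DcpoFunctor D C) :
    Fin (n + 1) → DcpoFunctor (D × C) C :=
  Fin.cases DcpoFunctor.snd (fun i => DcpoFunctor.fst.comp (ρ i))

/-- The interpretation of types: `sem ρ A` is the interpretation of `A` as a functor `Cⁿ ⥤ C`,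
precomposed with the functor `D ⥤ Cⁿ` whose components are the `ρ i`. -/
noncomputable def sem : {n : ℕ} → Ty n → {D : Type u} → [Category.{v} D] → [HomOrder D] →
    (Fin n → DcpoFunctor D C) → DcpoFunctor D C
  | _, var i, _, _, _, ρ => ρ i
  | _, one, _, _, _, _ => DcpoFunctor.const (𝟙_ C)
  | _, sum A B, _, _, _, ρ => ((sem A ρ).pair (sem B ρ)).comp osumFunctor
  | _, tensor A B, _, _, _, ρ => ((sem A ρ).pair (sem B ρ)).comp tensorFunctor
  | _, mu A, _, _, _, ρ => sharp (sem A (liftEnv ρ))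

theorem sem_comp {n : ℕ} (A : Ty n) {D E : Type u} [Category.{v} D] [HomOrder D] [Category.{v} E]
    [HomOrder E] (K : DcpoFunctor E D) (ρ : Fin n → DcpoFunctor D C) :
    sem A (fun i => K.comp (ρ i)) = K.comp (sem A ρ) := by
  induction A generalizing D E with
  | var i => rfl
  | one => rfl
  | sum A B ihA ihB => simp only [sem, ihA, ihB]; rfl
  | tensor A B ihA ihB => simp only [sem, ihA, ihB]; rfl
  | mu A ih =>
    simp only [sem]
    rw [← sharp_reindex, ← ih]
    congr 2
    funext i
    refine Fin.cases ?_ (fun i => ?_) i <;> rfl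

theorem sem_rename {m : ℕ} (A : Ty m) {n : ℕ} (r : Fin m → Fin n) {D : Type u} [Category.{v} D]
    [HomOrder D] (ρ : Fin n → DcpoFunctor D C) :
    sem (rename r A) ρ = sem A (fun i => ρ (r i)) := by
  induction A generalizing n D with
  | var i => rfl
  | one => rfl
  | sum A B ihA ihB => simp only [sem, rename, ihA, ihB]
  | tensor A B ihA ihB => simp only [sem, rename, ihA, ihB]
  | mu A ih =>
    simp only [sem, rename, ih]
    congr 2
    funext i
    refine Fin.cases ?_ (fun i => ?_) i <;> rfl

/-- Substitution of types is interpreted by composition of functors. -/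
theorem sem_subst {m : ℕ} (A : Ty m) {n : ℕ} (s : Fin m → Ty n) {D : Type u} [Category.{v} D]
    [HomOrder D] (ρ : Fin n → DcpoFunctor D C) :
    sem (subst s A) ρ = sem A (fun i => sem (s i) ρ) := by
  induction A generalizing n D with
  | var i => rfl
  | one => rfl
  | sum A B ihA ihB => simp only [sem, subst, ihA, ihB]
  | tensor A B ihA ihB => simp only [sem, subst, ihA, ihB]
  | mu A ih =>
    simp only [sem, subst, ih]
    congr 2
    funext i
    refine Fin.cases ?_ (fun i => ?_) i
    · rfl
    · change sem (rename Fin.succ (s i)) (liftEnv ρ) = DcpoFunctor.fst.comp (sem (s i) ρ)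
      rw [sem_rename, ← sem_comp]
      rfl

variable (C) in
/-- The interpretation of closed types as objects of `C`. -/
noncomputable def obj (A : Ty 0) : C :=
  (sem (D := Fin 0 → C) A Fin.elim0).obj Fin.elim0

variable (C) in
/-- The interpretation of `X ⊨ A` as a dcpo-endofunctor of `C` (with a trivial parameter). -/
noncomputable def endo (A : Ty 1) : DcpoFunctor C C :=
  (sem (D := (Fin 0 → C) × C) A (liftEnv Fin.elim0)).partialApp Fin.elim0

theorem obj_unfold (A : Ty 1) : obj C (unfold A) = (endo C A).obj (obj C (mu A)) := by
  have h : sem (D := Fin 0 → C) (unfold A) Fin.elim0 =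
      (DcpoFunctor.pair DcpoFunctor.id (sem (D := Fin 0 → C) (mu A) Fin.elim0)).comp
        (sem (D := (Fin 0 → C) × C) A (liftEnv Fin.elim0)) := by
    rw [unfold, sem_subst, ← sem_comp]
    congr 1
    funext i
    refine Fin.cases ?_ (fun i => i.elim0) i
    rfl
  unfold obj
  rw [h]
  rfl

variable (C) in
/-- The structure isomorphism `⟦A[μX.A/X]⟧ ⟶ ⟦μX.A⟧` of the initial algebra. -/
noncomputable def fold (A : Ty 1) : obj C (unfold A) ⟶ obj C (mu A) :=
  eqToHom (obj_unfold A) ≫ (initialAlgebra (endo C A)).str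

end Semantics

end Ty

end RevIso

namespace RevIso

open RestrictionCategory JoinInverseCategory

/-! ### Syntax and typing

Typing derivations are represented directly, as terms indexed by their contexts and types, so
that bound names play no role. -/

/-- Types of isos: `A ↔ B`, or functions between isos. -/
inductive ITy : Type
  | base (A B : Ty 0) : ITy
  | arrow (T₁ T₂ : ITy) : ITy

/-- Linear contexts of term variables. -/
abbrev Ctx := List (Ty 0)

/-- Contexts of iso-variables. -/
abbrev ICtx := List ITy

/-- Iso-variables of a given type in a context (de Bruijn indices). -/
inductive IVar : ICtx → ITy → Type
  | here {Ψ : ICtx} {T : ITy} : IVar (T :: Ψ) T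
  | there {Ψ : ICtx} {T T' : ITy} : IVar Ψ T → IVar (T' :: Ψ) T

/-- `Split Δ Δ₁ Δ₂`: each variable of `Δ` is assigned to exactly one of `Δ₁` and `Δ₂`. That is,
`Δ` is `Δ₁, Δ₂` up to the order of the variables. -/
inductive Split : Ctx → Ctx → Ctx → Type
  | nil : Split [] [] []
  | left {A : Ty 0} {Δ Δ₁ Δ₂ : Ctx} : Split Δ Δ₁ Δ₂ → Split (A :: Δ) (A :: Δ₁) Δ₂
  | right {A : Ty 0} {Δ Δ₁ Δ₂ : Ctx} : Split Δ Δ₁ Δ₂ → Split (A :: Δ) Δ₁ (A :: Δ₂)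

/-- `Pat A Γ`: patterns `p ::= x | ⟨p₁, p₂⟩` of type `A` that bind the variables `Γ`. -/
inductive Pat : Ty 0 → Ctx → Type
  | var {A : Ty 0} : Pat A [A]
  | pair {A B : Ty 0} {Γ₁ Γ₂ : Ctx} : Pat A Γ₁ → Pat B Γ₂ → Pat (.tensor A B) (Γ₁ ++ Γ₂)

mutual

/-- `Tm Ψ Δ A`: terms `t` with `Ψ; Δ ⊢ t : A`. The side conditions on the clauses of isos are
imposed separately, by `Tm.WF`. -/
inductive Tm : ICtx → Ctx → Ty 0 → Type
  | unit {Ψ : ICtx} : Tm Ψ [] .one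
  | var {Ψ : ICtx} {A : Ty 0} : Tm Ψ [A] A
  | inl {Ψ : ICtx} {Δ : Ctx} {A B : Ty 0} : Tm Ψ Δ A → Tm Ψ Δ (.sum A B)
  | inr {Ψ : ICtx} {Δ : Ctx} {A B : Ty 0} : Tm Ψ Δ B → Tm Ψ Δ (.sum A B)
  | pair {Ψ : ICtx} {Δ Δ₁ Δ₂ : Ctx} {A B : Ty 0} :
      Split Δ Δ₁ Δ₂ → Tm Ψ Δ₁ A → Tm Ψ Δ₂ B → Tm Ψ Δ (.tensor A B)
  | fold {Ψ : ICtx} {Δ : Ctx} {A : Ty 1} : Tm Ψ Δ A.unfold → Tm Ψ Δ (.mu A)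
  | app {Ψ : ICtx} {Δ : Ctx} {A B : Ty 0} : IsoTm Ψ (.base A B) → Tm Ψ Δ A → Tm Ψ Δ B
  | letp {Ψ : ICtx} {Δ Δ₁ Δ₂ Γ : Ctx} {A B : Ty 0} :
      Split Δ Δ₁ Δ₂ → Pat A Γ → Tm Ψ Δ₁ A → Tm Ψ (Γ ++ Δ₂) B → Tm Ψ Δ B

/-- `IsoTm Ψ T`: isos `ω` with `Ψ ⊢ ω : T`. -/
inductive IsoTm : ICtx → ITy → Type
  | clauses {Ψ : ICtx} {A B : Ty 0} {n : ℕ} (Δ : Fin n → Ctx) (v : ∀ i, Tm Ψ (Δ i) A)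
      (e : ∀ i, Tm Ψ (Δ i) B) : IsoTm Ψ (.base A B)
  | fix {Ψ : ICtx} {T : ITy} : IsoTm (T :: Ψ) T → IsoTm Ψ T
  | lam {Ψ : ICtx} {T₁ T₂ : ITy} : IsoTm (T₁ :: Ψ) T₂ → IsoTm Ψ (.arrow T₁ T₂)
  | var {Ψ : ICtx} {T : ITy} : IVar Ψ T → IsoTm Ψ T
  | app {Ψ : ICtx} {T₁ T₂ : ITy} : IsoTm Ψ (.arrow T₁ T₂) → IsoTm Ψ T₁ → IsoTm Ψ T₂

end

/-- Values `v ::= () | x | inl v | inr v | ⟨v₁, v₂⟩ | fold v`. -/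
inductive IsVal : {Ψ : ICtx} → {Δ : Ctx} → {A : Ty 0} → Tm Ψ Δ A → Prop
  | unit {Ψ : ICtx} : IsVal (Tm.unit (Ψ := Ψ))
  | var {Ψ : ICtx} {A : Ty 0} : IsVal (Tm.var (Ψ := Ψ) (A := A))
  | inl {Ψ : ICtx} {Δ : Ctx} {A B : Ty 0} {v : Tm Ψ Δ A} : IsVal v → IsVal (Tm.inl (B := B) v)
  | inr {Ψ : ICtx} {Δ : Ctx} {A B : Ty 0} {v : Tm Ψ Δ B} : IsVal v → IsVal (Tm.inr (A := A) v)
  | pair {Ψ : ICtx} {Δ Δ₁ Δ₂ : Ctx} {A B : Ty 0} (s : Split Δ Δ₁ Δ₂) {v₁ : Tm Ψ Δ₁ A}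
      {v₂ : Tm Ψ Δ₂ B} : IsVal v₁ → IsVal v₂ → IsVal (Tm.pair s v₁ v₂)
  | fold {Ψ : ICtx} {Δ : Ctx} {A : Ty 1} {v : Tm Ψ Δ A.unfold} : IsVal v → IsVal (Tm.fold v)

/-- Terms that are patterns `p ::= x | ⟨p₁, p₂⟩`. -/
inductive IsPattern : {Ψ : ICtx} → {Δ : Ctx} → {A : Ty 0} → Tm Ψ Δ A → Prop
  | var {Ψ : ICtx} {A : Ty 0} : IsPattern (Tm.var (Ψ := Ψ) (A := A))
  | pair {Ψ : ICtx} {Δ Δ₁ Δ₂ : Ctx} {A B : Ty 0} (s : Split Δ Δ₁ Δ₂) {p₁ : Tm Ψ Δ₁ A}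
      {p₂ : Tm Ψ Δ₂ B} : IsPattern p₁ → IsPattern p₂ → IsPattern (Tm.pair s p₁ p₂)

/-- Expressions `e ::= v | let p₁ = ω p₂ in e`. -/
inductive IsExpr : {Ψ : ICtx} → {Δ : Ctx} → {A : Ty 0} → Tm Ψ Δ A → Prop
  | val {Ψ : ICtx} {Δ : Ctx} {A : Ty 0} {v : Tm Ψ Δ A} : IsVal v → IsExpr v
  | letp {Ψ : ICtx} {Δ Δ₁ Δ₂ Γ : Ctx} {A A' B : Ty 0} (s : Split Δ Δ₁ Δ₂) (p₁ : Pat A Γ)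
      (w : IsoTm Ψ (.base A' A)) {p₂ : Tm Ψ Δ₁ A'} {e : Tm Ψ (Γ ++ Δ₂) B} :
      IsPattern p₂ → IsExpr e → IsExpr (Tm.letp s p₁ (Tm.app w p₂) e)

/-- Orthogonality `t₁ ⊥ t₂`: the smallest relation that holds between `inl` and `inr` and is closed
under `inl`, `inr`, `fold`, both sides of a pair, and the body of a `let`. The side terms of pairs
and `let`s are arbitrary, and a `let` may occur on one side only. -/
inductive Orth {Ψ : ICtx} : {Δ₁ Δ₂ : Ctx} → {A : Ty 0} → Tm Ψ Δ₁ A → Tm Ψ Δ₂ A → Prop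
  | inl_inr {Δ₁ Δ₂ : Ctx} {A B : Ty 0} (t₁ : Tm Ψ Δ₁ A) (t₂ : Tm Ψ Δ₂ B) :
      Orth (Tm.inl t₁) (Tm.inr t₂)
  | inr_inl {Δ₁ Δ₂ : Ctx} {A B : Ty 0} (t₁ : Tm Ψ Δ₁ B) (t₂ : Tm Ψ Δ₂ A) :
      Orth (Tm.inr t₁) (Tm.inl t₂)
  | inl {Δ₁ Δ₂ : Ctx} {A B : Ty 0} {t₁ : Tm Ψ Δ₁ A} {t₂ : Tm Ψ Δ₂ A} :
      Orth t₁ t₂ → Orth (Tm.inl (B := B) t₁) (Tm.inl t₂)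
  | inr {Δ₁ Δ₂ : Ctx} {A B : Ty 0} {t₁ : Tm Ψ Δ₁ B} {t₂ : Tm Ψ Δ₂ B} :
      Orth t₁ t₂ → Orth (Tm.inr (A := A) t₁) (Tm.inr t₂)
  | pair_left {Δ₁ Δ₂ Δ₃ Δ₄ Δ Δ' : Ctx} {A B : Ty 0} {t₁ : Tm Ψ Δ₁ A} {t₂ : Tm Ψ Δ₂ A}
      (s : Split Δ Δ₁ Δ₃) (s' : Split Δ' Δ₂ Δ₄) (u₁ : Tm Ψ Δ₃ B) (u₂ : Tm Ψ Δ₄ B) :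
      Orth t₁ t₂ → Orth (Tm.pair s t₁ u₁) (Tm.pair s' t₂ u₂)
  | pair_right {Δ₁ Δ₂ Δ₃ Δ₄ Δ Δ' : Ctx} {A B : Ty 0} {t₁ : Tm Ψ Δ₁ B} {t₂ : Tm Ψ Δ₂ B}
      (s : Split Δ Δ₃ Δ₁) (s' : Split Δ' Δ₄ Δ₂) (u₁ : Tm Ψ Δ₃ A) (u₂ : Tm Ψ Δ₄ A) :
      Orth t₁ t₂ → Orth (Tm.pair s u₁ t₁) (Tm.pair s' u₂ t₂)
  | fold {Δ₁ Δ₂ : Ctx} {A : Ty 1} {t₁ : Tm Ψ Δ₁ A.unfold} {t₂ : Tm Ψ Δ₂ A.unfold} :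
      Orth t₁ t₂ → Orth (Tm.fold t₁) (Tm.fold t₂)
  | letp_left {Δ Δ₁ Δ₂ Δ' Γ : Ctx} {A B : Ty 0} (s : Split Δ Δ₁ Δ₂) (p : Pat A Γ)
      (u : Tm Ψ Δ₁ A) {t₁ : Tm Ψ (Γ ++ Δ₂) B} {t₂ : Tm Ψ Δ' B} :
      Orth t₁ t₂ → Orth (Tm.letp s p u t₁) t₂
  | letp_right {Δ Δ₁ Δ₂ Δ' Γ : Ctx} {A B : Ty 0} (s : Split Δ Δ₁ Δ₂) (p : Pat A Γ)
      (u : Tm Ψ Δ₁ A) {t₁ : Tm Ψ Δ' B} {t₂ : Tm Ψ (Γ ++ Δ₂) B} :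
      Orth t₁ t₂ → Orth t₁ (Tm.letp s p u t₂)

mutual

/-- All isos that occur in the term satisfy `IsoTm.WF`. -/
def Tm.WF : {Ψ : ICtx} → {Δ : Ctx} → {A : Ty 0} → Tm Ψ Δ A → Prop
  | _, _, _, .unit => True
  | _, _, _, .var => True
  | _, _, _, .inl t => t.WF
  | _, _, _, .inr t => t.WF
  | _, _, _, .pair _ t₁ t₂ => t₁.WF ∧ t₂.WF
  | _, _, _, .fold t => t.WF
  | _, _, _, .app w t => w.WF ∧ t.WF
  | _, _, _, .letp _ _ t₁ t₂ => t₁.WF ∧ t₂.WF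

/-- In every set of clauses `{v₁ ↔ e₁ | ⋯ | vₙ ↔ eₙ}` the `vᵢ` are values, the `eᵢ` are expressions,
and for `i ≠ j` both `vᵢ ⊥ vⱼ` and `eᵢ ⊥ eⱼ`. -/
def IsoTm.WF : {Ψ : ICtx} → {T : ITy} → IsoTm Ψ T → Prop
  | _, _, .clauses _ v e =>
      (∀ i, IsVal (v i) ∧ IsExpr (e i)) ∧ (∀ i, (v i).WF ∧ (e i).WF) ∧
        ∀ i j, i ≠ j → Orth (v i) (v j) ∧ Orth (e i) (e j)
  | _, _, .fix w => w.WF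
  | _, _, .lam w => w.WF
  | _, _, .var _ => True
  | _, _, .app w₁ w₂ => w₁.WF ∧ w₂.WF

end

/-! ### Substitution -/

/-- Extension of a renaming of iso-variables under a binder. -/
def IVar.liftRen {Ψ Ψ' : ICtx} (r : ∀ T, IVar Ψ T → IVar Ψ' T) (T₀ : ITy) :
    ∀ T, IVar (T₀ :: Ψ) T → IVar (T₀ :: Ψ') T
  | _, .here => .here
  | _, .there x => .there (r _ x)

mutual

/-- Renaming of iso-variables in terms. -/
def Tm.rename : {Ψ : ICtx} → {Δ : Ctx} → {A : Ty 0} → Tm Ψ Δ A → {Ψ' : ICtx} →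
    (∀ T, IVar Ψ T → IVar Ψ' T) → Tm Ψ' Δ A
  | _, _, _, .unit, _, _ => .unit
  | _, _, _, .var, _, _ => .var
  | _, _, _, .inl t, _, r => .inl (t.rename r)
  | _, _, _, .inr t, _, r => .inr (t.rename r)
  | _, _, _, .pair s t₁ t₂, _, r => .pair s (t₁.rename r) (t₂.rename r)
  | _, _, _, .fold t, _, r => .fold (t.rename r)
  | _, _, _, .app w t, _, r => .app (w.rename r) (t.rename r)
  | _, _, _, .letp s p t₁ t₂, _, r => .letp s p (t₁.rename r) (t₂.rename r)

/-- Renaming of iso-variables in isos. -/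
def IsoTm.rename : {Ψ : ICtx} → {T : ITy} → IsoTm Ψ T → {Ψ' : ICtx} →
    (∀ T, IVar Ψ T → IVar Ψ' T) → IsoTm Ψ' T
  | _, _, .clauses Δ v e, _, r => .clauses Δ (fun i => (v i).rename r) (fun i => (e i).rename r)
  | _, _, .fix w, _, r => .fix (w.rename (IVar.liftRen r _))
  | _, _, .lam w, _, r => .lam (w.rename (IVar.liftRen r _))
  | _, _, .var x, _, r => .var (r _ x)
  | _, _, .app w₁ w₂, _, r => .app (w₁.rename r) (w₂.rename r)

end

/-- Extension of a substitution for iso-variables under a binder. -/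
def IVar.liftSubst {Ψ Ψ' : ICtx} (σ : ∀ T, IVar Ψ T → IsoTm Ψ' T) (T₀ : ITy) :
    ∀ T, IVar (T₀ :: Ψ) T → IsoTm (T₀ :: Ψ') T
  | _, .here => .var .here
  | _, .there x => (σ _ x).rename (fun _ y => .there y)

mutual

/-- Substitution of isos for iso-variables in terms. -/
def Tm.isoSubst : {Ψ : ICtx} → {Δ : Ctx} → {A : Ty 0} → Tm Ψ Δ A → {Ψ' : ICtx} →
    (∀ T, IVar Ψ T → IsoTm Ψ' T) → Tm Ψ' Δ A
  | _, _, _, .unit, _, _ => .unit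
  | _, _, _, .var, _, _ => .var
  | _, _, _, .inl t, _, σ => .inl (t.isoSubst σ)
  | _, _, _, .inr t, _, σ => .inr (t.isoSubst σ)
  | _, _, _, .pair s t₁ t₂, _, σ => .pair s (t₁.isoSubst σ) (t₂.isoSubst σ)
  | _, _, _, .fold t, _, σ => .fold (t.isoSubst σ)
  | _, _, _, .app w t, _, σ => .app (w.isoSubst σ) (t.isoSubst σ)
  | _, _, _, .letp s p t₁ t₂, _, σ => .letp s p (t₁.isoSubst σ) (t₂.isoSubst σ)

/-- Substitution of isos for iso-variables in isos. -/
def IsoTm.isoSubst : {Ψ : ICtx} → {T : ITy} → IsoTm Ψ T → {Ψ' : ICtx} →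
    (∀ T, IVar Ψ T → IsoTm Ψ' T) → IsoTm Ψ' T
  | _, _, .clauses Δ v e, _, σ =>
      .clauses Δ (fun i => (v i).isoSubst σ) (fun i => (e i).isoSubst σ)
  | _, _, .fix w, _, σ => .fix (w.isoSubst (IVar.liftSubst σ _))
  | _, _, .lam w, _, σ => .lam (w.isoSubst (IVar.liftSubst σ _))
  | _, _, .var x, _, σ => σ _ x
  | _, _, .app w₁ w₂, _, σ => .app (w₁.isoSubst σ) (w₂.isoSubst σ)

end

/-- The substitution of `w` for the variable `0`. -/
def IVar.single {Ψ : ICtx} {T₀ : ITy} (w : IsoTm Ψ T₀) : ∀ T, IVar (T₀ :: Ψ) T → IsoTm Ψ T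
  | _, .here => w
  | _, .there x => .var x

/-- `w₁[w₂/φ]`, where `φ` is the variable `0`. -/
def IsoTm.inst {Ψ : ICtx} {T₀ T : ITy} (w₁ : IsoTm (T₀ :: Ψ) T) (w₂ : IsoTm Ψ T₀) : IsoTm Ψ T :=
  w₁.isoSubst (IVar.single w₂)

/-- `TSub Ψ Δ Θ`: substitutions that map each term variable of `Δ` to a term without free term
variables (`put`) or keep it (`keep`); `Θ` consists of the variables that are kept. -/
inductive TSub (Ψ : ICtx) : Ctx → Ctx → Type
  | nil : TSub Ψ [] []
  | keep {A : Ty 0} {Δ Θ : Ctx} : TSub Ψ Δ Θ → TSub Ψ (A :: Δ) (A :: Θ)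
  | put {A : Ty 0} {Δ Θ : Ctx} : Tm Ψ [] A → TSub Ψ Δ Θ → TSub Ψ (A :: Δ) Θ

namespace TSub

variable {Ψ : ICtx}

/-- The restrictions of a substitution to the two parts of a split context. -/
def split : {Δ Δ₁ Δ₂ Θ : Ctx} → Split Δ Δ₁ Δ₂ → TSub Ψ Δ Θ →
    Σ Θ₁ Θ₂ : Ctx, Split Θ Θ₁ Θ₂ × TSub Ψ Δ₁ Θ₁ × TSub Ψ Δ₂ Θ₂
  | _, _, _, _, .nil, .nil => ⟨[], [], .nil, .nil, .nil⟩
  | _, _, _, _, .left s, .keep σ =>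
      let ⟨_, _, s', σ₁, σ₂⟩ := split s σ
      ⟨_, _, .left s', .keep σ₁, σ₂⟩
  | _, _, _, _, .left s, .put t σ =>
      let ⟨_, _, s', σ₁, σ₂⟩ := split s σ
      ⟨_, _, s', .put t σ₁, σ₂⟩
  | _, _, _, _, .right s, .keep σ =>
      let ⟨_, _, s', σ₁, σ₂⟩ := split s σ
      ⟨_, _, .right s', σ₁, .keep σ₂⟩
  | _, _, _, _, .right s, .put t σ =>
      let ⟨_, _, s', σ₁, σ₂⟩ := split s σ
      ⟨_, _, s', σ₁, .put t σ₂⟩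

/-- The extension of a substitution by kept variables. -/
def keeps : (Γ : Ctx) → {Δ Θ : Ctx} → TSub Ψ Δ Θ → TSub Ψ (Γ ++ Δ) (Γ ++ Θ)
  | [], _, _, σ => σ
  | _ :: Γ, _, _, σ => .keep (keeps Γ σ)

/-- The concatenation of two closing substitutions. -/
def append : {Γ Δ : Ctx} → TSub Ψ Γ [] → TSub Ψ Δ [] → TSub Ψ (Γ ++ Δ) []
  | _, _, .nil, τ => τ
  | _, _, .put t σ, τ => .put t (append σ τ)

/-- The union of two closing substitutions with disjoint supports. -/
def merge : {Δ Δ₁ Δ₂ : Ctx} → Split Δ Δ₁ Δ₂ → TSub Ψ Δ₁ [] → TSub Ψ Δ₂ [] → TSub Ψ Δ []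
  | _, _, _, .nil, _, _ => .nil
  | _, _, _, .left s, .put t σ, τ => .put t (merge s σ τ)
  | _, _, _, .right s, σ, .put t τ => .put t (merge s σ τ)

end TSub

/-- The action `σ(t)` of a substitution on a term. -/
def Tm.subst : {Ψ : ICtx} → {Δ : Ctx} → {A : Ty 0} → Tm Ψ Δ A → {Θ : Ctx} → TSub Ψ Δ Θ →
    Tm Ψ Θ A
  | _, _, _, .unit, _, .nil => .unit
  | _, _, _, .var, _, .keep .nil => .var
  | _, _, _, .var, _, .put t .nil => t
  | _, _, _, .inl t, _, σ => .inl (t.subst σ)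
  | _, _, _, .inr t, _, σ => .inr (t.subst σ)
  | _, _, _, .pair s t₁ t₂, _, σ =>
      let ⟨_, _, s', σ₁, σ₂⟩ := TSub.split s σ
      .pair s' (t₁.subst σ₁) (t₂.subst σ₂)
  | _, _, _, .fold t, _, σ => .fold (t.subst σ)
  | _, _, _, .app w t, _, σ => .app w (t.subst σ)
  | _, _, _, .letp (Γ := Γ) s p t₁ t₂, _, σ =>
      let ⟨_, _, s', σ₁, σ₂⟩ := TSub.split s σ
      .letp s' p (t₁.subst σ₁) (t₂.subst (TSub.keeps Γ σ₂))

/-! ### Operational semantics -/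

/-- The matching predicate `σ[v] = w` for values. -/
inductive Match {Ψ : ICtx} : {Δ : Ctx} → {A : Ty 0} → Tm Ψ Δ A → Tm Ψ [] A → TSub Ψ Δ [] → Prop
  | unit : Match Tm.unit Tm.unit .nil
  | var {A : Ty 0} (w : Tm Ψ [] A) : Match Tm.var w (.put w .nil)
  | inl {Δ : Ctx} {A B : Ty 0} {v : Tm Ψ Δ A} {w : Tm Ψ [] A} {σ : TSub Ψ Δ []} :
      Match v w σ → Match (Tm.inl (B := B) v) (Tm.inl w) σ
  | inr {Δ : Ctx} {A B : Ty 0} {v : Tm Ψ Δ B} {w : Tm Ψ [] B} {σ : TSub Ψ Δ []} :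
      Match v w σ → Match (Tm.inr (A := A) v) (Tm.inr w) σ
  | pair {Δ Δ₁ Δ₂ : Ctx} {A B : Ty 0} (s : Split Δ Δ₁ Δ₂) {v₁ : Tm Ψ Δ₁ A} {v₂ : Tm Ψ Δ₂ B}
      {w₁ : Tm Ψ [] A} {w₂ : Tm Ψ [] B} {σ₁ : TSub Ψ Δ₁ []} {σ₂ : TSub Ψ Δ₂ []} :
      Match v₁ w₁ σ₁ → Match v₂ w₂ σ₂ →
      Match (Tm.pair s v₁ v₂) (Tm.pair .nil w₁ w₂) (TSub.merge s σ₁ σ₂)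
  | fold {Δ : Ctx} {A : Ty 1} {v : Tm Ψ Δ A.unfold} {w : Tm Ψ [] A.unfold} {σ : TSub Ψ Δ []} :
      Match v w σ → Match (Tm.fold v) (Tm.fold w) σ

/-- The matching predicate `σ[p] = w` for the patterns of `let`. -/
inductive PatMatch {Ψ : ICtx} : {A : Ty 0} → {Γ : Ctx} → Pat A Γ → Tm Ψ [] A → TSub Ψ Γ [] → Prop
  | var {A : Ty 0} (w : Tm Ψ [] A) : PatMatch Pat.var w (.put w .nil)
  | pair {A B : Ty 0} {Γ₁ Γ₂ : Ctx} {p₁ : Pat A Γ₁} {p₂ : Pat B Γ₂} {w₁ : Tm Ψ [] A}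
      {w₂ : Tm Ψ [] B} {σ₁ : TSub Ψ Γ₁ []} {σ₂ : TSub Ψ Γ₂ []} :
      PatMatch p₁ w₁ σ₁ → PatMatch p₂ w₂ σ₂ →
      PatMatch (Pat.pair p₁ p₂) (Tm.pair .nil w₁ w₂) (TSub.append σ₁ σ₂)

/-- Evaluation of isos. -/
inductive IsoStep {Ψ : ICtx} : {T : ITy} → IsoTm Ψ T → IsoTm Ψ T → Prop
  | fix {T : ITy} (w : IsoTm (T :: Ψ) T) : IsoStep (.fix w) (w.inst (.fix w))
  | beta {T₁ T₂ : ITy} (w₁ : IsoTm (T₁ :: Ψ) T₂) (w₂ : IsoTm Ψ T₁) :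
      IsoStep (.app (.lam w₁) w₂) (w₁.inst w₂)
  | app {T₁ T₂ : ITy} {w₁ w₁' : IsoTm Ψ (.arrow T₁ T₂)} (w₂ : IsoTm Ψ T₁) :
      IsoStep w₁ w₁' → IsoStep (.app w₁ w₂) (.app w₁' w₂)

/-- Evaluation `t → t'` of terms without free term variables. -/
inductive Step {Ψ : ICtx} : {A : Ty 0} → Tm Ψ [] A → Tm Ψ [] A → Prop
  | iso {A B : Ty 0} {w w' : IsoTm Ψ (.base A B)} (t : Tm Ψ [] A) :
      IsoStep w w' → Step (.app w t) (.app w' t)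
  | clause {A B : Ty 0} {n : ℕ} (Δ : Fin n → Ctx) (v : ∀ i, Tm Ψ (Δ i) A)
      (e : ∀ i, Tm Ψ (Δ i) B) (i : Fin n) {w : Tm Ψ [] A} {σ : TSub Ψ (Δ i) []} :
      IsVal w → Match (v i) w σ → Step (.app (.clauses Δ v e) w) ((e i).subst σ)
  | letp {A B : Ty 0} {Γ : Ctx} {p : Pat A Γ} {w : Tm Ψ [] A} {σ : TSub Ψ Γ []}
      (t : Tm Ψ (Γ ++ []) B) :
      IsVal w → PatMatch p w σ → Step (.letp .nil p w t) (t.subst (TSub.append σ .nil))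
  | inl {A B : Ty 0} {t t' : Tm Ψ [] A} : Step t t' → Step (.inl (B := B) t) (.inl t')
  | inr {A B : Ty 0} {t t' : Tm Ψ [] B} : Step t t' → Step (.inr (A := A) t) (.inr t')
  | fold {A : Ty 1} {t t' : Tm Ψ [] A.unfold} : Step t t' → Step (.fold t) (.fold t')
  | pair_left {A B : Ty 0} {t t' : Tm Ψ [] A} (u : Tm Ψ [] B) :
      Step t t' → Step (.pair .nil t u) (.pair .nil t' u)
  | pair_right {A B : Ty 0} {w : Tm Ψ [] A} {t t' : Tm Ψ [] B} :
      IsVal w → Step t t' → Step (.pair .nil w t) (.pair .nil w t')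
  | clauses_arg {A B : Ty 0} {n : ℕ} (Δ : Fin n → Ctx) (v : ∀ i, Tm Ψ (Δ i) A)
      (e : ∀ i, Tm Ψ (Δ i) B) {t t' : Tm Ψ [] A} :
      Step t t' → Step (.app (.clauses Δ v e) t) (.app (.clauses Δ v e) t')
  | letp_arg {A B : Ty 0} {Γ : Ctx} (p : Pat A Γ) {t t' : Tm Ψ [] A} (u : Tm Ψ (Γ ++ []) B) :
      Step t t' → Step (.letp .nil p t u) (.letp .nil p t' u)

/-- A closed term terminates if it evaluates to a value in finitely many steps. -/
def Terminates {A : Ty 0} (t : Tm [] [] A) : Prop :=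
  ∃ v : Tm [] [] A, IsVal v ∧ Relation.ReflTransGen Step t v

end RevIso

namespace RevIso

open RestrictionCategory JoinInverseCategory

/-! ### Denotational semantics -/

namespace Dom

/-- The one-point dcpo. -/
noncomputable def unit : Dom.{v} := ⟨PUnit⟩

/-- The product of dcpos. -/
noncomputable def prod (P Q : Dom.{v}) : Dom.{v} := ⟨P.carrier × Q.carrier⟩

/-- The dcpo of Scott continuous maps. -/
noncomputable def arrow (P Q : Dom.{v}) : Dom.{v} := ⟨ScottHom P.carrier Q.carrier⟩

/-- The dcpo of morphisms of a join inverse category. -/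
def hom {C : Type u} [Category.{v} C] [JoinInverseCategory C] (X Y : C) : Dom.{v} := ⟨X ⟶ Y⟩

end Dom

section Maps

variable {C : Type u} [Category.{v} C] [JoinInverseCategory C] {P : Dom.{v}}

/-- Pointwise composition, in diagrammatic order. -/
def compHom {X Y Z : C} (f : ScottHom P.carrier (X ⟶ Y)) (g : ScottHom P.carrier (Y ⟶ Z)) :
    ScottHom P.carrier (X ⟶ Z) :=
  ⟨fun x => f x ≫ g x, ScottContinuous.comp (f.scott.prodMk g.scott) scott_comp⟩

/-- Pointwise partial inverse. -/
noncomputable def pinvHom {X Y : C} (f : ScottHom P.carrier (X ⟶ Y)) :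
    ScottHom P.carrier (Y ⟶ X) :=
  ⟨fun x => pinv (f x), ScottContinuous.comp f.scott scott_pinv⟩

/-- Pointwise monoidal product. -/
def tensHom [MonoidalCategory C] [SymmetricCategory C] [DisjointnessTensor C]
    [JoinInverseRigCategory C] {X Y X' Y' : C} (f : ScottHom P.carrier (X ⟶ Y))
    (g : ScottHom P.carrier (X' ⟶ Y')) : ScottHom P.carrier (X ⊗ X' ⟶ Y ⊗ Y') :=
  ⟨fun x => f x ⊗ₘ g x, ScottContinuous.comp (f.scott.prodMk g.scott) scott_tensorHom⟩

/-- The pointwise join of a family of pairwise inverse compatible maps. The value carries no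
information if the maps are not pairwise inverse compatible. -/
noncomputable def joinHom {X Y : C} {n : ℕ} (f : Fin n → ScottHom P.carrier (X ⟶ Y)) :
    ScottHom P.carrier (X ⟶ Y) :=
  open Classical in
  if h : ∀ x i j, InverseCompatible (f i x) (f j x) then
    ⟨fun x => join (Set.range fun i => f i x), by
      have hc : ∀ x, CompatibleSet (Set.range fun i => f i x) := by
        rintro x _ ⟨i, rfl⟩ _ ⟨j, rfl⟩
        exact h x i j
      intro d hne hd a ha
      refine ⟨?_, fun t ht => join_le (hc a) t ?_⟩
      · rintro _ ⟨x, hx, rfl⟩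
        refine join_le (hc x) _ ?_
        rintro _ ⟨i, rfl⟩
        exact ((f i).scott.monotone (ha.1 hx)).trans (le_join (hc a) _ ⟨i, rfl⟩)
      · rintro _ ⟨i, rfl⟩
        refine ((f i).scott hne hd ha).2 ?_
        rintro _ ⟨x, hx, rfl⟩
        exact (le_join (hc x) _ ⟨i, rfl⟩).trans (ht ⟨x, hx, rfl⟩)⟩
  else ScottHom.const (zeroHom X Y)

end Maps

section Semantics

variable (C : Type u) [Category.{v} C] [MonoidalCategory C] [SymmetricCategory C]
  [JoinInverseCategory C] [DisjointnessTensor C] [JoinInverseRigCategory C]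
  [HasEmbeddingColimits C]

/-- The interpretation of iso types as dcpos. -/
noncomputable def ITy.dom : ITy → Dom.{v}
  | .base A B => Dom.hom (Ty.obj C A) (Ty.obj C B)
  | .arrow T₁ T₂ => Dom.arrow (ITy.dom T₁) (ITy.dom T₂)

/-- The interpretation of contexts of iso-variables as dcpos. -/
noncomputable def icDom : ICtx → Dom.{v}
  | [] => Dom.unit
  | T :: Ψ => Dom.prod (icDom Ψ) (ITy.dom C T)

/-- The interpretation of linear contexts as objects. -/
noncomputable def ctxObj : Ctx → C
  | [] => 𝟙_ C
  | A :: Δ => Ty.obj C A ⊗ ctxObj Δ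

variable {C}

/-- The projection given by an iso-variable. -/
noncomputable def IVar.sem : {Ψ : ICtx} → {T : ITy} → IVar Ψ T →
    ScottHom (icDom C Ψ).carrier (ITy.dom C T).carrier
  | _, _, .here => ScottHom.snd
  | _, _, .there x => ScottHom.comp x.sem ScottHom.fst

/-- The isomorphism `⟦Δ⟧ ≅ ⟦Δ₁⟧ ⊗ ⟦Δ₂⟧` given by a split context. -/
noncomputable def Split.sem : {Δ Δ₁ Δ₂ : Ctx} → Split Δ Δ₁ Δ₂ →
    (ctxObj C Δ ⟶ ctxObj C Δ₁ ⊗ ctxObj C Δ₂)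
  | _, _, _, .nil => (λ_ (𝟙_ C)).inv
  | _, _, _, .left (A := A) s => Ty.obj C A ◁ s.sem ≫ (α_ _ _ _).inv
  | _, _, _, .right (A := A) s =>
      Ty.obj C A ◁ s.sem ≫ (α_ _ _ _).inv ≫ (β_ _ _).hom ▷ _ ≫ (α_ _ _ _).hom

/-- The isomorphism `⟦Γ⟧ ⊗ ⟦Δ⟧ ≅ ⟦Γ, Δ⟧`. -/
noncomputable def appendSem : (Γ Δ : Ctx) → (ctxObj C Γ ⊗ ctxObj C Δ ⟶ ctxObj C (Γ ++ Δ))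
  | [], Δ => (λ_ (ctxObj C Δ)).hom
  | A :: Γ, Δ => (α_ _ _ _).hom ≫ Ty.obj C A ◁ appendSem Γ Δ

/-- The isomorphism `⟦A⟧ ≅ ⟦Γ⟧` given by a pattern of type `A` that binds `Γ`. -/
noncomputable def Pat.sem : {A : Ty 0} → {Γ : Ctx} → Pat A Γ → (Ty.obj C A ⟶ ctxObj C Γ)
  | A, _, .var => (ρ_ (Ty.obj C A)).inv
  | _, _, .pair (Γ₁ := Γ₁) (Γ₂ := Γ₂) p q => (p.sem ⊗ₘ q.sem) ≫ appendSem Γ₁ Γ₂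

mutual

/-- The interpretation of a term `Ψ; Δ ⊢ t : A` as a Scott continuous map from `⟦Ψ⟧` to the dcpo of
morphisms `⟦Δ⟧ ⟶ ⟦A⟧`. -/
noncomputable def Tm.sem : {Ψ : ICtx} → {Δ : Ctx} → {A : Ty 0} → Tm Ψ Δ A →
    ScottHom (icDom C Ψ).carrier (ctxObj C Δ ⟶ Ty.obj C A)
  | _, _, _, .unit => ScottHom.const (𝟙 (𝟙_ C))
  | _, _, _, .var (A := A) => ScottHom.const (ρ_ (Ty.obj C A)).hom
  | _, _, _, .inl (A := A) (B := B) t =>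
      compHom t.sem (ScottHom.const (injl (Ty.obj C A) (Ty.obj C B)))
  | _, _, _, .inr (A := A) (B := B) t =>
      compHom t.sem (ScottHom.const (injr (Ty.obj C A) (Ty.obj C B)))
  | _, _, _, .pair s t₁ t₂ => compHom (ScottHom.const s.sem) (tensHom t₁.sem t₂.sem)
  | _, _, _, .fold (A := A) t => compHom t.sem (ScottHom.const (Ty.fold C A))
  | _, _, _, .app w t => compHom t.sem w.sem
  | _, _, _, .letp (Γ := Γ) (Δ₂ := Δ₂) s p t₁ t₂ =>
      compHom
        (compHom (ScottHom.const s.sem)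
          (tensHom (compHom t₁.sem (ScottHom.const p.sem)) (ScottHom.const (𝟙 (ctxObj C Δ₂)))))
        (compHom (ScottHom.const (appendSem Γ Δ₂)) t₂.sem)

/-- The interpretation of an iso `Ψ ⊢ ω : T` as a Scott continuous map from `⟦Ψ⟧` to `⟦T⟧`. -/
noncomputable def IsoTm.sem : {Ψ : ICtx} → {T : ITy} → IsoTm Ψ T →
    ScottHom (icDom C Ψ).carrier (ITy.dom C T).carrier
  | _, _, .clauses _ v e => joinHom fun i => compHom (pinvHom (v i).sem) (e i).sem
  | _, _, .fix w => ScottHom.fix w.sem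
  | _, _, .lam w => ScottHom.curry w.sem
  | _, _, .var x => x.sem
  | _, _, .app w₁ w₂ => ScottHom.comp ScottHom.eval (ScottHom.pair w₁.sem w₂.sem)

end

variable (C) in
/-- The interpretation of a closed term, a morphism `1 ⟶ ⟦A⟧`. -/
noncomputable def Tm.den {A : Ty 0} (t : Tm [] [] A) : 𝟙_ C ⟶ Ty.obj C A :=
  t.sem PUnit.unit

end Semantics

end RevIso

open RevIso

/-!
The proof is a structural induction on terms and derivations, carried by a few facts about join
inverse rig categories.

*Orthogonality.* Empty joins commute with composition, so zero morphisms absorb composition. Hence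
they factor through the object `0`, and by `A ⊗ 0 ≅ 0` they absorb `⊗` as well
(`tensorHom_zeroHom`; preservation of joins gives this only for nonempty joins). The injections of
a sum are orthogonal by disjointness, and the relation `f° ∘ f' = 0` is stable under
precomposition, under postcomposition with total morphisms, and under
tensoring with arbitrary morphisms; this is `Orth.sem_comp_pinv`. For two different clauses of an
iso, all composites in the definition of inverse compatibility therefore vanish
(`inverseCompatible_of_orthogonal`), so the interpretation of a well-formed iso is the pointwise
join of its clauses (`IsoTm.WF.sem_clauses`).

*Subject reduction.* The syntax is intrinsically typed, so only the side conditions on clauses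
have to be transported along renamings and substitutions (`Step.wf`).

*Invariance under evaluation.* There are two substitution lemmas. Substitution of isos corresponds
to a change of the element of `⟦Ψ⟧` (`IsoTm.WF.sem_isoSubst`); with the fixed point equation it
handles `fix` and β-steps. Substitution of terms corresponds to composition with a morphism
`⟦Θ⟧ ⟶ ⟦Δ⟧` (`Tm.sem_subst`), which requires coherence of the isomorphisms for split contexts. If a value
`w` matches `vᵢ` with `σ`, then `w` denotes `vᵢ ∘ σ`; composing with the join of the clauses, the
`j`-th component for `j ≠ i` vanishes by orthogonality, and the `i`-th one is `eᵢ ∘ σ` because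
values are total (`IsoTm.WF.comp_sem_clauses`).

*Nonzero denotations.* A terminating term has the denotation of a value, which is total. If it
were zero, the identity of the tensor unit would be zero, and the tensor unit would be isomorphic
to `0`.
-/

namespace RevIso

open RestrictionCategory JoinInverseCategory

/-! ### Zero morphisms, partial inverses and total morphisms -/

section Zero

variable {C : Type u} [Category.{v} C] [JoinInverseCategory C]

theorem zeroHom_comp {X Y Z : C} (f : Y ⟶ Z) : zeroHom X Y ≫ f = zeroHom X Z := by
  unfold zeroHom
  rw [join_comp (fun _ h => h.elim), Set.image_empty]

theorem comp_zeroHom {X Y Z : C} (f : X ⟶ Y) : f ≫ zeroHom Y Z = zeroHom X Z := by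
  unfold zeroHom
  rw [comp_join (fun _ h => h.elim), Set.image_empty]

theorem res_zeroHom (X Y : C) : res (zeroHom X Y) = zeroHom X X := by
  unfold zeroHom
  rw [res_join (fun _ h => h.elim), Set.image_empty]

theorem zeroHom_le {X Y : C} (f : X ⟶ Y) : zeroHom X Y ≤ f :=
  join_le (fun _ h => h.elim) f (fun _ h => h.elim)

/-- Orthogonality `f° ∘ f' = 0` of morphisms with a common target is stable under precomposition. -/
theorem comp_comp_pinv_eq_zeroHom {X X' Y' Z : C} {f : X ⟶ Z} {f' : X' ⟶ Z}
    (h : f' ≫ pinv f = zeroHom X' X) (g' : Y' ⟶ X') : (g' ≫ f') ≫ pinv f = zeroHom Y' X := by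
  rw [Category.assoc, h, comp_zeroHom]

theorem comp_pinv_comp_eq_zeroHom {X X' Y Z : C} {f : X ⟶ Z} {f' : X' ⟶ Z}
    (h : f' ≫ pinv f = zeroHom X' X) (g : Y ⟶ X) : f' ≫ pinv (g ≫ f) = zeroHom X' Y := by
  rw [pinv_comp_rev, ← Category.assoc, h, zeroHom_comp]

theorem comp_comp_pinv_comp_eq_zeroHom {X X' Y Y' Z : C} {f : X ⟶ Z} {f' : X' ⟶ Z}
    (h : f' ≫ pinv f = zeroHom X' X) (g : Y ⟶ X) (g' : Y' ⟶ X') :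
    (g' ≫ f') ≫ pinv (g ≫ f) = zeroHom Y' Y :=
  comp_pinv_comp_eq_zeroHom (comp_comp_pinv_eq_zeroHom h g') g

/-- Clauses with orthogonal left-hand sides have disjoint domains of definition. -/
theorem res_comp_eq_zeroHom {X X' Y Z : C} {f : X ⟶ Z} {f' : X' ⟶ Z}
    (h : f' ≫ pinv f = zeroHom X' X) (g : X ⟶ Y) (g' : X' ⟶ Y) :
    res (pinv f' ≫ g') ≫ pinv f ≫ g = zeroHom Z Y := by
  rw [← comp_pinv, pinv_comp_rev, pinv_pinv]
  simp only [Category.assoc]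
  rw [← Category.assoc f', h, zeroHom_comp]
  simp only [comp_zeroHom]

theorem inverseCompatible_refl {X Y : C} (f : X ⟶ Y) : InverseCompatible f f :=
  inverseCompatible_of_le le_rfl le_rfl

/-- Clauses with orthogonal left-hand sides and orthogonal right-hand sides are inverse
compatible: all four composites to be compared vanish. -/
theorem inverseCompatible_of_orthogonal {X X' Y Z : C} {v : X ⟶ Z} {v' : X' ⟶ Z} {e : X ⟶ Y}
    {e' : X' ⟶ Y} (hv : v' ≫ pinv v = zeroHom X' X) (hv' : v ≫ pinv v' = zeroHom X X')
    (he : e' ≫ pinv e = zeroHom X' X) (he' : e ≫ pinv e' = zeroHom X X') :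
    InverseCompatible (pinv v ≫ e) (pinv v' ≫ e') := by
  unfold InverseCompatible RestrictionCompatible
  rw [pinv_comp_rev (pinv v), pinv_comp_rev (pinv v'), pinv_pinv, pinv_pinv]
  exact ⟨(res_comp_eq_zeroHom hv _ _).trans (res_comp_eq_zeroHom hv' _ _).symm,
    (res_comp_eq_zeroHom he _ _).trans (res_comp_eq_zeroHom he' _ _).symm⟩

theorem Total.comp_pinv {X Y : C} {f : X ⟶ Y} (hf : Total f) : f ≫ pinv f = 𝟙 X :=
  (RevIso.comp_pinv f).trans hf

theorem Total.comp {X Y Z : C} {f : X ⟶ Y} {g : Y ⟶ Z} (hf : Total f) (hg : Total g) :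
    Total (f ≫ g) :=
  total_of_comp_eq_id (g := pinv g ≫ pinv f) (by
    rw [Category.assoc, ← Category.assoc g, hg.comp_pinv, Category.id_comp, hf.comp_pinv])

theorem total_of_isIso {X Y : C} (f : X ⟶ Y) [IsIso f] : Total f :=
  total_of_comp_eq_id (IsIso.hom_inv_id f)

/-- Postcomposition with a total morphism does not change the composite `f₁° ∘ f₂`. -/
theorem comp_comp_pinv_of_total {X X' Y Z : C} (f : X ⟶ Y) (f' : X' ⟶ Y) {g : Y ⟶ Z}
    (hg : Total g) : (f' ≫ g) ≫ pinv (f ≫ g) = f' ≫ pinv f := by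
  rw [pinv_comp_rev, Category.assoc, ← Category.assoc g, hg.comp_pinv, Category.id_comp]

end Zero

section Disjoint

variable {C : Type u} [Category.{v} C] [JoinInverseCategory C] [DisjointnessTensor C]

theorem injr_comp_pinv_injl (X Y : C) : injr X Y ≫ pinv (injl X Y) = zeroHom Y X := by
  have h : res (pinv (injr X Y)) ≫ res (pinv (injl X Y)) = zeroHom (osum X Y) (osum X Y) :=
    DisjointnessTensor.disjoint X Y
  calc injr X Y ≫ pinv (injl X Y)
      = injr X Y ≫ (res (pinv (injr X Y)) ≫ res (pinv (injl X Y))) ≫ pinv (injl X Y) := by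
        rw [Category.assoc, res_comp_self, ← Category.assoc, ← pinv_comp, ← Category.assoc,
          comp_pinv, res_comp_self]
    _ = zeroHom Y X := by rw [h, zeroHom_comp, comp_zeroHom]

theorem injl_comp_pinv_injr (X Y : C) : injl X Y ≫ pinv (injr X Y) = zeroHom X Y := by
  have h : res (pinv (injr X Y)) ≫ res (pinv (injl X Y)) = zeroHom (osum X Y) (osum X Y) :=
    DisjointnessTensor.disjoint X Y
  rw [res_comm] at h
  calc injl X Y ≫ pinv (injr X Y)
      = injl X Y ≫ (res (pinv (injl X Y)) ≫ res (pinv (injr X Y))) ≫ pinv (injr X Y) := by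
        rw [Category.assoc, res_comp_self, ← Category.assoc, ← pinv_comp, ← Category.assoc,
          comp_pinv, res_comp_self]
    _ = zeroHom X Y := by rw [h, zeroHom_comp, comp_zeroHom]

/-- If the identity of an object is the zero morphism, the object is isomorphic to `0`. -/
noncomputable def zeroObjIso {X : C} (h : 𝟙 X = zeroHom X X) : zeroObj C ≅ X where
  hom := zeroHom _ _
  inv := zeroHom _ _
  hom_inv_id := zeroObj_src _ _
  inv_hom_id := by rw [zeroHom_comp, h]

theorem hom_ext_of_iso_zeroObj {X Y : C} (e : X ≅ zeroObj C) (f g : X ⟶ Y) : f = g := by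
  rw [← cancel_epi e.inv]
  exact zeroObj_src _ _

end Disjoint

section Tensor

variable {C : Type u} [Category.{v} C] [MonoidalCategory C] [SymmetricCategory C]
  [JoinInverseCategory C] [DisjointnessTensor C] [JoinInverseRigCategory C]

theorem res_tensorHom {X Y X' Y' : C} (f : X ⟶ Y) (g : X' ⟶ Y') :
    res (f ⊗ₘ g) = res f ⊗ₘ res g :=
  JoinInverseRigCategory.tensor_joinPreserving.tensor_res f g

theorem pinv_tensorHom {X Y X' Y' : C} (f : X ⟶ Y) (g : X' ⟶ Y') :
    pinv (f ⊗ₘ g) = pinv f ⊗ₘ pinv g :=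
  (eq_pinv (by rw [tensorHom_comp_tensorHom, comp_pinv, comp_pinv, res_tensorHom])
    (by rw [tensorHom_comp_tensorHom, pinv_comp, pinv_comp, res_tensorHom])).symm

theorem Total.tensorHom {X Y X' Y' : C} {f : X ⟶ Y} {g : X' ⟶ Y'} (hf : Total f)
    (hg : Total g) : Total (f ⊗ₘ g) := by
  unfold Total at *
  rw [res_tensorHom, hf, hg, id_tensorHom_id]

/-- The tensor product preserves only nonempty joins by assumption; that it preserves zero
morphisms follows from `A ⊗ 0 ≅ 0`, since zero morphisms factor through `0`. -/
theorem tensorHom_zeroHom {X Y X' Y' : C} (f : X ⟶ Y) :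
    f ⊗ₘ zeroHom X' Y' = zeroHom (X ⊗ X') (Y ⊗ Y') := by
  obtain ⟨e⟩ := JoinInverseRigCategory.annihil X
  have h : f ⊗ₘ zeroHom X' Y' =
      (𝟙 X ⊗ₘ zeroHom X' (zeroObj C)) ≫ (f ⊗ₘ zeroHom (zeroObj C) Y') := by
    rw [tensorHom_comp_tensorHom, Category.id_comp, zeroHom_comp]
  rw [h, hom_ext_of_iso_zeroObj e (f ⊗ₘ zeroHom (zeroObj C) Y') (zeroHom _ _), comp_zeroHom]

theorem zeroHom_tensorHom {X Y X' Y' : C} (f : X ⟶ Y) :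
    zeroHom X' Y' ⊗ₘ f = zeroHom (X' ⊗ X) (Y' ⊗ Y) := by
  have h := BraidedCategory.braiding_naturality (zeroHom X' Y') f
  rw [tensorHom_zeroHom, comp_zeroHom] at h
  rw [← cancel_mono (β_ Y' Y).hom, h, zeroHom_comp]

theorem tensorHom_comp_pinv_left {X₁ X₁' Y₁ X₂ X₂' Y₂ : C} {f : X₁ ⟶ Y₁} {f' : X₁' ⟶ Y₁}
    (h : f' ≫ pinv f = zeroHom X₁' X₁) (k : X₂ ⟶ Y₂) (k' : X₂' ⟶ Y₂) :
    (f' ⊗ₘ k') ≫ pinv (f ⊗ₘ k) = zeroHom (X₁' ⊗ X₂') (X₁ ⊗ X₂) := by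
  rw [pinv_tensorHom, tensorHom_comp_tensorHom, h, zeroHom_tensorHom]

theorem tensorHom_comp_pinv_right {X₁ X₁' Y₁ X₂ X₂' Y₂ : C} {f : X₁ ⟶ Y₁} {f' : X₁' ⟶ Y₁}
    (h : f' ≫ pinv f = zeroHom X₁' X₁) (k : X₂ ⟶ Y₂) (k' : X₂' ⟶ Y₂) :
    (k' ⊗ₘ f') ≫ pinv (k ⊗ₘ f) = zeroHom (X₂' ⊗ X₁') (X₂ ⊗ X₁) := by
  rw [pinv_tensorHom, tensorHom_comp_tensorHom, h, tensorHom_zeroHom]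

/-- The structure morphism `⟦A[μX.A/X]⟧ ⟶ ⟦μX.A⟧` is an isomorphism, by Lambek's lemma. -/
theorem isIso_fold [HasEmbeddingColimits C] (A : Ty 1) : IsIso (Ty.fold C A) := by
  have : IsIso (initialAlgebra (Ty.endo C A)).str :=
    Endofunctor.Algebra.Initial.str_isIso (initialAlgebraIsInitial _)
  exact IsIso.comp_isIso' inferInstance this

end Tensor

/-! ### Well-formedness is stable under renaming and substitution -/

theorem IsVal.rename {Ψ Ψ' : ICtx} {Δ : Ctx} {A : Ty 0} {t : Tm Ψ Δ A} (ht : IsVal t)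
    (r : ∀ T, IVar Ψ T → IVar Ψ' T) : IsVal (t.rename r) := by
  induction ht with
  | unit => exact .unit
  | var => exact .var
  | inl _ ih => exact .inl ih
  | inr _ ih => exact .inr ih
  | pair s _ _ ih₁ ih₂ => exact .pair s ih₁ ih₂
  | fold _ ih => exact .fold ih

theorem IsPattern.rename {Ψ Ψ' : ICtx} {Δ : Ctx} {A : Ty 0} {t : Tm Ψ Δ A} (ht : IsPattern t)
    (r : ∀ T, IVar Ψ T → IVar Ψ' T) : IsPattern (t.rename r) := by
  induction ht with
  | var => exact .var
  | pair s _ _ ih₁ ih₂ => exact .pair s ih₁ ih₂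

theorem IsExpr.rename {Ψ Ψ' : ICtx} {Δ : Ctx} {A : Ty 0} {t : Tm Ψ Δ A} (ht : IsExpr t)
    (r : ∀ T, IVar Ψ T → IVar Ψ' T) : IsExpr (t.rename r) := by
  induction ht with
  | val hv => exact .val (hv.rename r)
  | letp s p w hp _ ih => exact .letp s p (w.rename r) (hp.rename r) ih

theorem Orth.rename {Ψ Ψ' : ICtx} {Δ₁ Δ₂ : Ctx} {A : Ty 0} {t₁ : Tm Ψ Δ₁ A} {t₂ : Tm Ψ Δ₂ A}
    (h : Orth t₁ t₂) (r : ∀ T, IVar Ψ T → IVar Ψ' T) : Orth (t₁.rename r) (t₂.rename r) := by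
  induction h with
  | inl_inr t₁ t₂ => exact .inl_inr _ _
  | inr_inl t₁ t₂ => exact .inr_inl _ _
  | inl _ ih => exact .inl ih
  | inr _ ih => exact .inr ih
  | pair_left s s' u₁ u₂ _ ih => exact .pair_left s s' _ _ ih
  | pair_right s s' u₁ u₂ _ ih => exact .pair_right s s' _ _ ih
  | fold _ ih => exact .fold ih
  | letp_left s p u _ ih => exact .letp_left s p _ ih
  | letp_right s p u _ ih => exact .letp_right s p _ ih

mutual

theorem Tm.WF.rename : ∀ {Ψ : ICtx} {Δ : Ctx} {A : Ty 0} (t : Tm Ψ Δ A), t.WF →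
    ∀ {Ψ' : ICtx} (r : ∀ T, IVar Ψ T → IVar Ψ' T), (t.rename r).WF
  | _, _, _, .unit, _, _, _ => trivial
  | _, _, _, .var, _, _, _ => trivial
  | _, _, _, .inl t, h, _, r => Tm.WF.rename t h r
  | _, _, _, .inr t, h, _, r => Tm.WF.rename t h r
  | _, _, _, .pair _ t₁ t₂, h, _, r => ⟨Tm.WF.rename t₁ h.1 r, Tm.WF.rename t₂ h.2 r⟩
  | _, _, _, .fold t, h, _, r => Tm.WF.rename t h r
  | _, _, _, .app w t, h, _, r => ⟨IsoTm.WF.rename w h.1 r, Tm.WF.rename t h.2 r⟩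
  | _, _, _, .letp _ _ t₁ t₂, h, _, r => ⟨Tm.WF.rename t₁ h.1 r, Tm.WF.rename t₂ h.2 r⟩

theorem IsoTm.WF.rename : ∀ {Ψ : ICtx} {T : ITy} (w : IsoTm Ψ T), w.WF →
    ∀ {Ψ' : ICtx} (r : ∀ T, IVar Ψ T → IVar Ψ' T), (w.rename r).WF
  | _, _, .clauses _ v e, h, _, r =>
      ⟨fun i => ⟨(h.1 i).1.rename r, (h.1 i).2.rename r⟩,
        fun i => ⟨Tm.WF.rename (v i) (h.2.1 i).1 r, Tm.WF.rename (e i) (h.2.1 i).2 r⟩,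
        fun i j hij => ⟨(h.2.2 i j hij).1.rename r, (h.2.2 i j hij).2.rename r⟩⟩
  | _, _, .fix w, h, _, r => IsoTm.WF.rename w h (IVar.liftRen r _)
  | _, _, .lam w, h, _, r => IsoTm.WF.rename w h (IVar.liftRen r _)
  | _, _, .var _, _, _, _ => trivial
  | _, _, .app w₁ w₂, h, _, r => ⟨IsoTm.WF.rename w₁ h.1 r, IsoTm.WF.rename w₂ h.2 r⟩

end

theorem IsVal.isoSubst {Ψ Ψ' : ICtx} {Δ : Ctx} {A : Ty 0} {t : Tm Ψ Δ A} (ht : IsVal t)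
    (σ : ∀ T, IVar Ψ T → IsoTm Ψ' T) : IsVal (t.isoSubst σ) := by
  induction ht with
  | unit => exact .unit
  | var => exact .var
  | inl _ ih => exact .inl ih
  | inr _ ih => exact .inr ih
  | pair s _ _ ih₁ ih₂ => exact .pair s ih₁ ih₂
  | fold _ ih => exact .fold ih

theorem IsPattern.isoSubst {Ψ Ψ' : ICtx} {Δ : Ctx} {A : Ty 0} {t : Tm Ψ Δ A}
    (ht : IsPattern t) (σ : ∀ T, IVar Ψ T → IsoTm Ψ' T) : IsPattern (t.isoSubst σ) := by
  induction ht with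
  | var => exact .var
  | pair s _ _ ih₁ ih₂ => exact .pair s ih₁ ih₂

theorem IsExpr.isoSubst {Ψ Ψ' : ICtx} {Δ : Ctx} {A : Ty 0} {t : Tm Ψ Δ A} (ht : IsExpr t)
    (σ : ∀ T, IVar Ψ T → IsoTm Ψ' T) : IsExpr (t.isoSubst σ) := by
  induction ht with
  | val hv => exact .val (hv.isoSubst σ)
  | letp s p w hp _ ih => exact .letp s p (w.isoSubst σ) (hp.isoSubst σ) ih

theorem Orth.isoSubst {Ψ Ψ' : ICtx} {Δ₁ Δ₂ : Ctx} {A : Ty 0} {t₁ : Tm Ψ Δ₁ A}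
    {t₂ : Tm Ψ Δ₂ A} (h : Orth t₁ t₂) (σ : ∀ T, IVar Ψ T → IsoTm Ψ' T) :
    Orth (t₁.isoSubst σ) (t₂.isoSubst σ) := by
  induction h with
  | inl_inr t₁ t₂ => exact .inl_inr _ _
  | inr_inl t₁ t₂ => exact .inr_inl _ _
  | inl _ ih => exact .inl ih
  | inr _ ih => exact .inr ih
  | pair_left s s' u₁ u₂ _ ih => exact .pair_left s s' _ _ ih
  | pair_right s s' u₁ u₂ _ ih => exact .pair_right s s' _ _ ih
  | fold _ ih => exact .fold ih
  | letp_left s p u _ ih => exact .letp_left s p _ ih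
  | letp_right s p u _ ih => exact .letp_right s p _ ih

theorem IVar.wf_liftSubst {Ψ Ψ' : ICtx} {σ : ∀ T, IVar Ψ T → IsoTm Ψ' T}
    (hσ : ∀ T x, (σ T x).WF) (T₀ : ITy) : ∀ T x, (IVar.liftSubst σ T₀ T x).WF
  | _, .here => trivial
  | _, .there x => IsoTm.WF.rename _ (hσ _ x) _

mutual

theorem Tm.WF.isoSubst : ∀ {Ψ : ICtx} {Δ : Ctx} {A : Ty 0} (t : Tm Ψ Δ A), t.WF →
    ∀ {Ψ' : ICtx} {σ : ∀ T, IVar Ψ T → IsoTm Ψ' T}, (∀ T x, (σ T x).WF) → (t.isoSubst σ).WF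
  | _, _, _, .unit, _, _, _, _ => trivial
  | _, _, _, .var, _, _, _, _ => trivial
  | _, _, _, .inl t, h, _, _, hσ => Tm.WF.isoSubst t h hσ
  | _, _, _, .inr t, h, _, _, hσ => Tm.WF.isoSubst t h hσ
  | _, _, _, .pair _ t₁ t₂, h, _, _, hσ =>
      ⟨Tm.WF.isoSubst t₁ h.1 hσ, Tm.WF.isoSubst t₂ h.2 hσ⟩
  | _, _, _, .fold t, h, _, _, hσ => Tm.WF.isoSubst t h hσ
  | _, _, _, .app w t, h, _, _, hσ => ⟨IsoTm.WF.isoSubst w h.1 hσ, Tm.WF.isoSubst t h.2 hσ⟩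
  | _, _, _, .letp _ _ t₁ t₂, h, _, _, hσ =>
      ⟨Tm.WF.isoSubst t₁ h.1 hσ, Tm.WF.isoSubst t₂ h.2 hσ⟩

theorem IsoTm.WF.isoSubst : ∀ {Ψ : ICtx} {T : ITy} (w : IsoTm Ψ T), w.WF →
    ∀ {Ψ' : ICtx} {σ : ∀ T, IVar Ψ T → IsoTm Ψ' T}, (∀ T x, (σ T x).WF) → (w.isoSubst σ).WF
  | _, _, .clauses _ v e, h, _, σ, hσ =>
      ⟨fun i => ⟨(h.1 i).1.isoSubst σ, (h.1 i).2.isoSubst σ⟩,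
        fun i => ⟨Tm.WF.isoSubst (v i) (h.2.1 i).1 hσ, Tm.WF.isoSubst (e i) (h.2.1 i).2 hσ⟩,
        fun i j hij => ⟨(h.2.2 i j hij).1.isoSubst σ, (h.2.2 i j hij).2.isoSubst σ⟩⟩
  | _, _, .fix w, h, _, _, hσ => IsoTm.WF.isoSubst w h (IVar.wf_liftSubst hσ _)
  | _, _, .lam w, h, _, _, hσ => IsoTm.WF.isoSubst w h (IVar.wf_liftSubst hσ _)
  | _, _, .var x, _, _, _, hσ => hσ _ x
  | _, _, .app w₁ w₂, h, _, _, hσ => ⟨IsoTm.WF.isoSubst w₁ h.1 hσ, IsoTm.WF.isoSubst w₂ h.2 hσ⟩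

end

theorem IVar.wf_single {Ψ : ICtx} {T₀ : ITy} {w : IsoTm Ψ T₀} (hw : w.WF) :
    ∀ T x, (IVar.single w T x).WF
  | _, .here => hw
  | _, .there _ => trivial

theorem IsoTm.WF.inst {Ψ : ICtx} {T₀ T : ITy} {w₁ : IsoTm (T₀ :: Ψ) T} {w₂ : IsoTm Ψ T₀}
    (h₁ : w₁.WF) (h₂ : w₂.WF) : (w₁.inst w₂).WF :=
  IsoTm.WF.isoSubst w₁ h₁ (IVar.wf_single h₂)

namespace TSub

variable {Ψ : ICtx}

/-- All terms of the substitution are well formed. -/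
def WF : {Δ Θ : Ctx} → TSub Ψ Δ Θ → Prop
  | _, _, .nil => True
  | _, _, .keep σ => σ.WF
  | _, _, .put t σ => t.WF ∧ σ.WF

theorem WF.split : ∀ {Δ Δ₁ Δ₂ Θ : Ctx} (s : Split Δ Δ₁ Δ₂) (σ : TSub Ψ Δ Θ), σ.WF →
    (TSub.split s σ).2.2.2.1.WF ∧ (TSub.split s σ).2.2.2.2.WF
  | _, _, _, _, .nil, .nil, _ => ⟨trivial, trivial⟩
  | _, _, _, _, .left s, .keep σ, h => WF.split s σ h
  | _, _, _, _, .left s, .put _ σ, h => ⟨⟨h.1, (WF.split s σ h.2).1⟩, (WF.split s σ h.2).2⟩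
  | _, _, _, _, .right s, .keep σ, h => WF.split s σ h
  | _, _, _, _, .right s, .put _ σ, h => ⟨(WF.split s σ h.2).1, h.1, (WF.split s σ h.2).2⟩

theorem WF.keeps : ∀ (Γ : Ctx) {Δ Θ : Ctx} {σ : TSub Ψ Δ Θ}, σ.WF → (TSub.keeps Γ σ).WF
  | [], _, _, _, h => h
  | _ :: Γ, _, _, _, h => WF.keeps Γ h

theorem WF.append : ∀ {Γ Δ : Ctx} (σ : TSub Ψ Γ []) {τ : TSub Ψ Δ []}, σ.WF → τ.WF →
    (TSub.append σ τ).WF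
  | _, _, .nil, _, _, hτ => hτ
  | _, _, .put _ σ, _, hσ, hτ => ⟨hσ.1, WF.append σ hσ.2 hτ⟩

theorem WF.merge : ∀ {Δ Δ₁ Δ₂ : Ctx} (s : Split Δ Δ₁ Δ₂) (σ : TSub Ψ Δ₁ []) (τ : TSub Ψ Δ₂ []),
    σ.WF → τ.WF → (TSub.merge s σ τ).WF
  | _, _, _, .nil, _, _, _, _ => trivial
  | _, _, _, .left s, .put _ σ, τ, hσ, hτ => ⟨hσ.1, WF.merge s σ τ hσ.2 hτ⟩
  | _, _, _, .right s, σ, .put _ τ, hσ, hτ => ⟨hτ.1, WF.merge s σ τ hσ hτ.2⟩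

end TSub

theorem Tm.WF.subst : ∀ {Ψ : ICtx} {Δ : Ctx} {A : Ty 0} (t : Tm Ψ Δ A), t.WF →
    ∀ {Θ : Ctx} (σ : TSub Ψ Δ Θ), σ.WF → (t.subst σ).WF
  | _, _, _, .unit, _, _, .nil, _ => trivial
  | _, _, _, .var, _, _, .keep .nil, _ => trivial
  | _, _, _, .var, _, _, .put _ .nil, hσ => hσ.1
  | _, _, _, .inl t, h, _, σ, hσ => Tm.WF.subst t h σ hσ
  | _, _, _, .inr t, h, _, σ, hσ => Tm.WF.subst t h σ hσ
  | _, _, _, .pair s t₁ t₂, h, _, σ, hσ =>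
      ⟨Tm.WF.subst t₁ h.1 _ (TSub.WF.split s σ hσ).1,
        Tm.WF.subst t₂ h.2 _ (TSub.WF.split s σ hσ).2⟩
  | _, _, _, .fold t, h, _, σ, hσ => Tm.WF.subst t h σ hσ
  | _, _, _, .app _ t, h, _, σ, hσ => ⟨h.1, Tm.WF.subst t h.2 σ hσ⟩
  | _, _, _, .letp (Γ := Γ) s _ t₁ t₂, h, _, σ, hσ =>
      ⟨Tm.WF.subst t₁ h.1 _ (TSub.WF.split s σ hσ).1,
        Tm.WF.subst t₂ h.2 _ (TSub.WF.keeps Γ (TSub.WF.split s σ hσ).2)⟩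

theorem Match.wf {Ψ : ICtx} {Δ : Ctx} {A : Ty 0} {v : Tm Ψ Δ A} {w : Tm Ψ [] A}
    {σ : TSub Ψ Δ []} (h : Match v w σ) (hw : w.WF) : σ.WF := by
  induction h with
  | unit => trivial
  | var w => exact ⟨hw, trivial⟩
  | inl _ ih => exact ih hw
  | inr _ ih => exact ih hw
  | pair s _ _ ih₁ ih₂ => exact TSub.WF.merge s _ _ (ih₁ hw.1) (ih₂ hw.2)
  | fold _ ih => exact ih hw

theorem PatMatch.wf {Ψ : ICtx} {A : Ty 0} {Γ : Ctx} {p : Pat A Γ} {w : Tm Ψ [] A}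
    {σ : TSub Ψ Γ []} (h : PatMatch p w σ) (hw : w.WF) : σ.WF := by
  induction h with
  | var w => exact ⟨hw, trivial⟩
  | pair _ _ ih₁ ih₂ => exact TSub.WF.append _ (ih₁ hw.1) (ih₂ hw.2)

theorem IsoStep.wf {Ψ : ICtx} {T : ITy} {w w' : IsoTm Ψ T} (h : IsoStep w w') (hw : w.WF) :
    w'.WF := by
  induction h with
  | fix w => exact IsoTm.WF.inst hw hw
  | beta w₁ w₂ => exact IsoTm.WF.inst hw.1 hw.2
  | app w₂ _ ih => exact ⟨ih hw.1, hw.2⟩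

theorem Step.wf {Ψ : ICtx} {A : Ty 0} {t t' : Tm Ψ [] A} (h : Step t t') (ht : t.WF) :
    t'.WF := by
  induction h with
  | iso t h => exact ⟨h.wf ht.1, ht.2⟩
  | clause Δ v e i _ hm => exact Tm.WF.subst _ (ht.1.2.1 i).2 _ (hm.wf ht.2)
  | letp t _ hm => exact Tm.WF.subst _ ht.2 _ (TSub.WF.append _ (hm.wf ht.1) trivial)
  | inl _ ih => exact ih ht
  | inr _ ih => exact ih ht
  | fold _ ih => exact ih ht
  | pair_left u _ ih => exact ⟨ih ht.1, ht.2⟩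
  | pair_right _ _ ih => exact ⟨ht.1, ih ht.2⟩
  | clauses_arg Δ v e _ ih => exact ⟨ht.1, ih ht.2⟩
  | letp_arg p u _ ih => exact ⟨ih ht.1, ht.2⟩

/-! ### Parametrised least fixed points -/

namespace ScottHom

variable {α α' β : Type v} [PartialOrder α] [PartialOrder α'] [CompletePartialOrder β]

theorem approx_succ_apply (f : ScottHom (α × β) β) (n : ℕ) (x : α) :
    approx f (n + 1) x = f (x, approx f n x) := rfl

theorem monotone_approx (f : ScottHom (α × β) β) : Monotone (approx f) := by
  apply monotone_nat_of_le_succ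
  intro n
  induction n with
  | zero => exact bot_le
  | succ n ih => exact fun x => f.scott.monotone (Prod.mk_le_mk.2 ⟨le_rfl, ih x⟩)

theorem isLUB_fix_apply (f : ScottHom (α × β) β) (x : α) :
    IsLUB (Set.range fun n => approx f n x) (fix f x) := by
  have hd : DirectedOn (· ≤ ·) (Set.range (approx f)) :=
    (monotone_approx f).directed_le.directedOn_range
  have h := scott_apply x (Set.range_nonempty _) hd hd.isLUB_sSup
  rwa [← Set.range_comp] at h

/-- The value of `fix f` at `x` depends only on the section `f (x, -)`. -/
theorem fix_apply_congr {f : ScottHom (α × β) β} {f' : ScottHom (α' × β) β} {x : α} {x' : α'}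
    (h : ∀ y, f (x, y) = f' (x', y)) : fix f x = fix f' x' := by
  have ha : ∀ n, approx f n x = approx f' n x' := by
    intro n
    induction n with
    | zero => rfl
    | succ n ih => rw [approx_succ_apply, approx_succ_apply, ih, h]
  have h₁ := isLUB_fix_apply f x
  simp only [ha] at h₁
  exact h₁.unique (isLUB_fix_apply f' x')

theorem fix_apply_eq (f : ScottHom (α × β) β) (x : α) : fix f x = f (x, fix f x) := by
  have hm : Monotone fun n => approx f n x := fun _ _ h => monotone_approx f h x
  have hs : ScottContinuous fun y => f (x, y) :=
    ScottContinuous.comp ((ScottContinuous.const x).prodMk ScottContinuous.id) f.scott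
  have h := hs (Set.range_nonempty _) hm.directed_le.directedOn_range (isLUB_fix_apply f x)
  rw [← Set.range_comp] at h
  refine IsLUB.unique ?_ h
  refine ⟨?_, fun t ht => (isLUB_fix_apply f x).2 ?_⟩
  · rintro _ ⟨n, rfl⟩
    exact (isLUB_fix_apply f x).1 ⟨n + 1, rfl⟩
  · rintro _ ⟨n, rfl⟩
    exact (hm n.le_succ).trans (ht ⟨n, rfl⟩)

end ScottHom

/-! ### Orthogonality and the interpretation of clauses -/

theorem joinHom_apply {C : Type u} [Category.{v} C] [JoinInverseCategory C]
    {P : Dom.{v}} {X Y : C} {n : ℕ}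
    {f : Fin n → ScottHom P.carrier (X ⟶ Y)}
    (h : ∀ x i j, InverseCompatible (f i x) (f j x)) (x : P.carrier) :
    joinHom f x = join (Set.range fun i => f i x) := by
  unfold joinHom
  rw [dif_pos h]

section Clauses

variable {C : Type u} [Category.{v} C] [MonoidalCategory C] [SymmetricCategory C]
  [JoinInverseCategory C] [DisjointnessTensor C] [JoinInverseRigCategory C]
  [HasEmbeddingColimits C]

theorem Orth.sem_comp_pinv {Ψ : ICtx} {Δ₁ Δ₂ : Ctx} {A : Ty 0} {t₁ : Tm Ψ Δ₁ A}
    {t₂ : Tm Ψ Δ₂ A} (h : Orth t₁ t₂) (g : (icDom C Ψ).carrier) :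
    t₂.sem g ≫ pinv (t₁.sem g) = zeroHom (ctxObj C Δ₂) (ctxObj C Δ₁) := by
  induction h with
  | inl_inr t₁ t₂ => exact comp_comp_pinv_comp_eq_zeroHom (injr_comp_pinv_injl _ _) _ _
  | inr_inl t₁ t₂ => exact comp_comp_pinv_comp_eq_zeroHom (injl_comp_pinv_injr _ _) _ _
  | inl _ ih => exact (comp_comp_pinv_of_total _ _ (DisjointnessTensor.inl_total _ _)).trans ih
  | inr _ ih => exact (comp_comp_pinv_of_total _ _ (DisjointnessTensor.inr_total _ _)).trans ih
  | pair_left s s' u₁ u₂ _ ih =>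
    exact comp_comp_pinv_comp_eq_zeroHom (tensorHom_comp_pinv_left ih _ _) _ _
  | pair_right s s' u₁ u₂ _ ih =>
    exact comp_comp_pinv_comp_eq_zeroHom (tensorHom_comp_pinv_right ih _ _) _ _
  | fold _ ih =>
    have := isIso_fold (C := C)
    exact (comp_comp_pinv_of_total _ _ (total_of_isIso (Ty.fold C _))).trans ih
  | letp_left s p u _ ih => exact comp_pinv_comp_eq_zeroHom (comp_pinv_comp_eq_zeroHom ih _) _
  | letp_right s p u _ ih => exact comp_comp_pinv_eq_zeroHom (comp_comp_pinv_eq_zeroHom ih _) _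

theorem Orth.symm {Ψ : ICtx} {Δ₁ Δ₂ : Ctx} {A : Ty 0} {t₁ : Tm Ψ Δ₁ A} {t₂ : Tm Ψ Δ₂ A}
    (h : Orth t₁ t₂) : Orth t₂ t₁ := by
  induction h with
  | inl_inr t₁ t₂ => exact .inr_inl _ _
  | inr_inl t₁ t₂ => exact .inl_inr _ _
  | inl _ ih => exact .inl ih
  | inr _ ih => exact .inr ih
  | pair_left s s' u₁ u₂ _ ih => exact .pair_left s' s _ _ ih
  | pair_right s s' u₁ u₂ _ ih => exact .pair_right s' s _ _ ih
  | fold _ ih => exact .fold ih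
  | letp_left s p u _ ih => exact .letp_right s p u ih
  | letp_right s p u _ ih => exact .letp_left s p u ih

variable {Ψ : ICtx} {A B : Ty 0} {n : ℕ} {Δ : Fin n → Ctx} {v : ∀ i, Tm Ψ (Δ i) A}
  {e : ∀ i, Tm Ψ (Δ i) B}

theorem IsoTm.WF.inverseCompatible (h : (IsoTm.clauses Δ v e).WF) (g : (icDom C Ψ).carrier)
    (i j : Fin n) : InverseCompatible (pinv ((v i).sem g) ≫ (e i).sem g)
      (pinv ((v j).sem g) ≫ (e j).sem g) := by
  by_cases hij : i = j
  · subst hij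
    exact inverseCompatible_refl _
  · have ho := h.2.2 i j hij
    exact inverseCompatible_of_orthogonal (ho.1.sem_comp_pinv g) (ho.1.symm.sem_comp_pinv g)
      (ho.2.sem_comp_pinv g) (ho.2.symm.sem_comp_pinv g)

theorem IsoTm.WF.compatibleSet (h : (IsoTm.clauses Δ v e).WF) (g : (icDom C Ψ).carrier) :
    CompatibleSet (Set.range fun i => pinv ((v i).sem g) ≫ (e i).sem g) := by
  rintro _ ⟨i, rfl⟩ _ ⟨j, rfl⟩
  exact h.inverseCompatible g i j

theorem IsoTm.WF.sem_clauses (h : (IsoTm.clauses Δ v e).WF) (g : (icDom C Ψ).carrier) :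
    (IsoTm.clauses Δ v e).sem (C := C) g =
      join (Set.range fun i => pinv ((v i).sem g) ≫ (e i).sem g) :=
  joinHom_apply (fun g i j => h.inverseCompatible g i j) g

theorem IsoTm.WF.isLUB_sem_clauses (h : (IsoTm.clauses Δ v e).WF) (g : (icDom C Ψ).carrier) :
    IsLUB (Set.range fun i => pinv ((v i).sem g) ≫ (e i).sem g)
      ((IsoTm.clauses Δ v e).sem (C := C) g) := by
  rw [h.sem_clauses g]
  exact ⟨fun s hs => le_join (h.compatibleSet g) s hs,
    fun t ht => join_le (h.compatibleSet g) t ht⟩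

end Clauses

/-! ### Substitution of isos in the semantics -/

section IsoSubst

variable {C : Type u} [Category.{v} C] [MonoidalCategory C] [SymmetricCategory C]
  [JoinInverseCategory C] [DisjointnessTensor C] [JoinInverseRigCategory C]
  [HasEmbeddingColimits C]

theorem IVar.sem_liftRen {Ψ Ψ' : ICtx} {r : ∀ T, IVar Ψ T → IVar Ψ' T}
    {g : (icDom C Ψ').carrier} {g' : (icDom C Ψ).carrier}
    (hr : ∀ T x, (r T x).sem g = x.sem g') (T₀ : ITy) (y : (ITy.dom C T₀).carrier) :
    ∀ T (x : IVar (T₀ :: Ψ) T), (IVar.liftRen r T₀ T x).sem (C := C) (g, y) = x.sem (g', y)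
  | _, .here => rfl
  | _, .there x => hr _ x

mutual

/-- Well-formedness is needed here, as the interpretation of ill-formed clauses depends on the
whole of `⟦Ψ⟧` and not only on the given element. -/
theorem Tm.WF.sem_rename : ∀ {Ψ : ICtx} {Δ : Ctx} {A : Ty 0} (t : Tm Ψ Δ A), t.WF →
    ∀ {Ψ' : ICtx} {r : ∀ T, IVar Ψ T → IVar Ψ' T} {g : (icDom C Ψ').carrier}
    {g' : (icDom C Ψ).carrier}, (∀ T x, (r T x).sem g = x.sem g') →
    (t.rename r).sem g = t.sem g'
  | _, _, _, .unit, _, _, _, _, _, _ => rfl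
  | _, _, _, .var, _, _, _, _, _, _ => rfl
  | _, _, _, .inl t, h, _, _, _, _, hr =>
      congrArg (fun f => f ≫ injl _ _) (Tm.WF.sem_rename t h hr)
  | _, _, _, .inr t, h, _, _, _, _, hr =>
      congrArg (fun f => f ≫ injr _ _) (Tm.WF.sem_rename t h hr)
  | _, _, _, .pair s t₁ t₂, h, _, _, _, _, hr =>
      congrArg₂ (fun f k => s.sem ≫ (f ⊗ₘ k)) (Tm.WF.sem_rename t₁ h.1 hr)
        (Tm.WF.sem_rename t₂ h.2 hr)
  | _, _, _, .fold t, h, _, _, _, _, hr =>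
      congrArg (fun f => f ≫ Ty.fold C _) (Tm.WF.sem_rename t h hr)
  | _, _, _, .app (A := A) (B := B) w t, h, _, _, _, _, hr =>
      congrArg₂ (fun f (k : Ty.obj C A ⟶ Ty.obj C B) => f ≫ k) (Tm.WF.sem_rename t h.2 hr)
        (IsoTm.WF.sem_rename w h.1 hr)
  | _, _, _, .letp s p t₁ t₂, h, _, _, _, _, hr =>
      congrArg₂ (fun f k => (s.sem ≫ ((f ≫ p.sem) ⊗ₘ 𝟙 _)) ≫ appendSem _ _ ≫ k)
        (Tm.WF.sem_rename t₁ h.1 hr) (Tm.WF.sem_rename t₂ h.2 hr)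

theorem IsoTm.WF.sem_rename : ∀ {Ψ : ICtx} {T : ITy} (w : IsoTm Ψ T), w.WF →
    ∀ {Ψ' : ICtx} {r : ∀ T, IVar Ψ T → IVar Ψ' T} {g : (icDom C Ψ').carrier}
    {g' : (icDom C Ψ).carrier}, (∀ T x, (r T x).sem g = x.sem g') →
    (w.rename r).sem g = w.sem g'
  | _, _, .clauses Δ v e, h, _, r, g, g', hr => by
      refine (IsoTm.WF.sem_clauses (IsoTm.WF.rename _ h r) g).trans
        (Eq.trans ?_ (IsoTm.WF.sem_clauses h g').symm)
      congr 2
      funext i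
      rw [Tm.WF.sem_rename (v i) (h.2.1 i).1 hr, Tm.WF.sem_rename (e i) (h.2.1 i).2 hr]
  | _, _, .fix w, h, _, _, _, _, hr =>
      ScottHom.fix_apply_congr fun y => IsoTm.WF.sem_rename w h (IVar.sem_liftRen hr _ y)
  | _, _, .lam w, h, _, _, _, _, hr =>
      ScottHom.ext (funext fun y => IsoTm.WF.sem_rename w h (IVar.sem_liftRen hr _ y))
  | _, _, .var x, _, _, _, _, _, hr => hr _ x
  | _, _, .app (T₁ := T₁) (T₂ := T₂) w₁ w₂, h, _, _, _, _, hr =>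
      congrArg₂ (fun (f : ScottHom (ITy.dom C T₁).carrier (ITy.dom C T₂).carrier) y => f y)
        (IsoTm.WF.sem_rename w₁ h.1 hr) (IsoTm.WF.sem_rename w₂ h.2 hr)

end

theorem IVar.sem_liftSubst {Ψ Ψ' : ICtx} {σ : ∀ T, IVar Ψ T → IsoTm Ψ' T}
    (hσ : ∀ T x, (σ T x).WF) {g : (icDom C Ψ').carrier} {g' : (icDom C Ψ).carrier}
    (h : ∀ T x, (σ T x).sem g = x.sem g') (T₀ : ITy) (y : (ITy.dom C T₀).carrier) :
    ∀ T (x : IVar (T₀ :: Ψ) T), (IVar.liftSubst σ T₀ T x).sem (C := C) (g, y) = x.sem (g', y)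
  | _, .here => rfl
  | _, .there x => (IsoTm.WF.sem_rename (σ _ x) (hσ _ x) (r := fun _ z => .there z)
      (g := (g, y)) (g' := g) fun _ _ => rfl).trans (h _ x)

mutual

/-- Substitution of isos is interpreted by changing the element of `⟦Ψ⟧`. The comparison is made at
a single element `g`, which suffices even under binders, as least fixed points and curried maps at
`g` depend only on their sections at `g`. -/
theorem Tm.WF.sem_isoSubst : ∀ {Ψ : ICtx} {Δ : Ctx} {A : Ty 0} (t : Tm Ψ Δ A), t.WF →
    ∀ {Ψ' : ICtx} {σ : ∀ T, IVar Ψ T → IsoTm Ψ' T}, (∀ T x, (σ T x).WF) →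
    ∀ {g : (icDom C Ψ').carrier} {g' : (icDom C Ψ).carrier},
    (∀ T x, (σ T x).sem g = x.sem g') → (t.isoSubst σ).sem g = t.sem g'
  | _, _, _, .unit, _, _, _, _, _, _, _ => rfl
  | _, _, _, .var, _, _, _, _, _, _, _ => rfl
  | _, _, _, .inl t, h, _, _, hσ, _, _, hr =>
      congrArg (fun f => f ≫ injl _ _) (Tm.WF.sem_isoSubst t h hσ hr)
  | _, _, _, .inr t, h, _, _, hσ, _, _, hr =>
      congrArg (fun f => f ≫ injr _ _) (Tm.WF.sem_isoSubst t h hσ hr)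
  | _, _, _, .pair s t₁ t₂, h, _, _, hσ, _, _, hr =>
      congrArg₂ (fun f k => s.sem ≫ (f ⊗ₘ k)) (Tm.WF.sem_isoSubst t₁ h.1 hσ hr)
        (Tm.WF.sem_isoSubst t₂ h.2 hσ hr)
  | _, _, _, .fold t, h, _, _, hσ, _, _, hr =>
      congrArg (fun f => f ≫ Ty.fold C _) (Tm.WF.sem_isoSubst t h hσ hr)
  | _, _, _, .app (A := A) (B := B) w t, h, _, _, hσ, _, _, hr =>
      congrArg₂ (fun f (k : Ty.obj C A ⟶ Ty.obj C B) => f ≫ k)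
        (Tm.WF.sem_isoSubst t h.2 hσ hr) (IsoTm.WF.sem_isoSubst w h.1 hσ hr)
  | _, _, _, .letp s p t₁ t₂, h, _, _, hσ, _, _, hr =>
      congrArg₂ (fun f k => (s.sem ≫ ((f ≫ p.sem) ⊗ₘ 𝟙 _)) ≫ appendSem _ _ ≫ k)
        (Tm.WF.sem_isoSubst t₁ h.1 hσ hr) (Tm.WF.sem_isoSubst t₂ h.2 hσ hr)

theorem IsoTm.WF.sem_isoSubst : ∀ {Ψ : ICtx} {T : ITy} (w : IsoTm Ψ T), w.WF →
    ∀ {Ψ' : ICtx} {σ : ∀ T, IVar Ψ T → IsoTm Ψ' T}, (∀ T x, (σ T x).WF) →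
    ∀ {g : (icDom C Ψ').carrier} {g' : (icDom C Ψ).carrier},
    (∀ T x, (σ T x).sem g = x.sem g') → (w.isoSubst σ).sem g = w.sem g'
  | _, _, .clauses Δ v e, h, _, σ, hσ, g, g', hr => by
      refine (IsoTm.WF.sem_clauses (IsoTm.WF.isoSubst _ h hσ) g).trans
        (Eq.trans ?_ (IsoTm.WF.sem_clauses h g').symm)
      congr 2
      funext i
      rw [Tm.WF.sem_isoSubst (v i) (h.2.1 i).1 hσ hr, Tm.WF.sem_isoSubst (e i) (h.2.1 i).2 hσ hr]
  | _, _, .fix w, h, _, _, hσ, _, _, hr =>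
      ScottHom.fix_apply_congr fun y =>
        IsoTm.WF.sem_isoSubst w h (IVar.wf_liftSubst hσ _) (IVar.sem_liftSubst hσ hr _ y)
  | _, _, .lam w, h, _, _, hσ, _, _, hr =>
      ScottHom.ext (funext fun y =>
        IsoTm.WF.sem_isoSubst w h (IVar.wf_liftSubst hσ _) (IVar.sem_liftSubst hσ hr _ y))
  | _, _, .var x, _, _, _, _, _, _, hr => hr _ x
  | _, _, .app (T₁ := T₁) (T₂ := T₂) w₁ w₂, h, _, _, hσ, _, _, hr =>
      congrArg₂ (fun (f : ScottHom (ITy.dom C T₁).carrier (ITy.dom C T₂).carrier) y => f y)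
        (IsoTm.WF.sem_isoSubst w₁ h.1 hσ hr) (IsoTm.WF.sem_isoSubst w₂ h.2 hσ hr)

end

theorem IVar.sem_single {Ψ : ICtx} {T₀ : ITy} (w : IsoTm Ψ T₀) (g : (icDom C Ψ).carrier) :
    ∀ T (x : IVar (T₀ :: Ψ) T), (IVar.single w T x).sem (C := C) g = x.sem (g, w.sem g)
  | _, .here => rfl
  | _, .there _ => rfl

theorem IsoTm.WF.sem_inst {Ψ : ICtx} {T₀ T : ITy} {w₁ : IsoTm (T₀ :: Ψ) T} {w₂ : IsoTm Ψ T₀}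
    (h₁ : w₁.WF) (h₂ : w₂.WF) (g : (icDom C Ψ).carrier) :
    (w₁.inst w₂).sem (C := C) g = w₁.sem (g, w₂.sem g) :=
  IsoTm.WF.sem_isoSubst w₁ h₁ (IVar.wf_single h₂) (IVar.sem_single w₂ g)

theorem IsoStep.sem_eq {Ψ : ICtx} {T : ITy} {w w' : IsoTm Ψ T} (h : IsoStep w w') (hw : w.WF)
    (g : (icDom C Ψ).carrier) : w.sem (C := C) g = w'.sem g := by
  induction h with
  | fix w => exact (ScottHom.fix_apply_eq _ g).trans (IsoTm.WF.sem_inst hw hw g).symm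
  | beta w₁ w₂ => exact (IsoTm.WF.sem_inst hw.1 hw.2 g).symm
  | @app T₁ T₂ w₁ w₁' w₂ _ ih =>
    exact congrArg (fun f : ScottHom (ITy.dom C T₁).carrier (ITy.dom C T₂).carrier => f (w₂.sem g))
      (ih hw.1)

end IsoSubst

/-! ### Coherence for split contexts -/

section Coherence

variable {C : Type u} [Category.{v} C] [MonoidalCategory C] {X₁ X₂ Y Y₁ Y₂ Z A : C}
  {σ : X₁ ⟶ Y} {s : Y ⟶ Y₁ ⊗ Y₂} {s' : X₁ ⟶ X₂ ⊗ Z} {σ₁ : X₂ ⟶ Y₁} {σ₂ : Z ⟶ Y₂}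

/-- One of the four inductive steps for pushing a substitution through a split context: the first
variable is kept (`keep`) or replaced by a term (`put`), and it goes to the left or to the right. -/
theorem split_keep_left (h : σ ≫ s = s' ≫ (σ₁ ⊗ₘ σ₂)) :
    A ◁ σ ≫ A ◁ s ≫ (α_ _ _ _).inv = (A ◁ s' ≫ (α_ _ _ _).inv) ≫ (A ◁ σ₁ ⊗ₘ σ₂) := by
  rw [← whiskerLeft_comp_assoc, h, whiskerLeft_comp_assoc, Category.assoc, ← id_tensorHom A σ₁,
    ← associator_inv_naturality, id_tensorHom]

theorem split_put_left {t : 𝟙_ C ⟶ A} (h : σ ≫ s = s' ≫ (σ₁ ⊗ₘ σ₂)) :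
    ((λ_ _).inv ≫ (t ⊗ₘ σ)) ≫ A ◁ s ≫ (α_ _ _ _).inv =
      s' ≫ (((λ_ _).inv ≫ (t ⊗ₘ σ₁)) ⊗ₘ σ₂) := by
  have h₁ : ((λ_ X₁).inv ≫ (t ⊗ₘ σ)) ≫ A ◁ s = s' ≫ (λ_ _).inv ≫ (t ⊗ₘ (σ₁ ⊗ₘ σ₂)) := by
    rw [← id_tensorHom A s, Category.assoc, tensorHom_comp_tensorHom, Category.comp_id, h,
      leftUnitor_inv_naturality_assoc, ← id_tensorHom, tensorHom_comp_tensorHom,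
      Category.id_comp]
  rw [← Category.assoc, h₁, Category.assoc, Category.assoc, associator_inv_naturality,
    ← Category.assoc (λ_ _).inv,
    show (λ_ (X₂ ⊗ Z)).inv ≫ (α_ _ _ _).inv = (λ_ X₂).inv ▷ Z by monoidal, ← tensorHom_id,
    tensorHom_comp_tensorHom, Category.id_comp]

/-- The inductive step for the concatenation of closing substitutions. -/
theorem append_put {G D H : C} {t : 𝟙_ C ⟶ A} {σ : 𝟙_ C ⟶ G} {τ : 𝟙_ C ⟶ D} (a : G ⊗ D ⟶ H) :
    (λ_ _).inv ≫ (((λ_ _).inv ≫ (t ⊗ₘ σ)) ⊗ₘ τ) ≫ (α_ _ _ _).hom ≫ A ◁ a =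
      (λ_ _).inv ≫ (t ⊗ₘ ((λ_ _).inv ≫ (σ ⊗ₘ τ) ≫ a)) := by
  have h₁ : ((λ_ (𝟙_ C)).inv ≫ (t ⊗ₘ σ)) ⊗ₘ τ =
      (λ_ (𝟙_ C)).inv ▷ 𝟙_ C ≫ ((t ⊗ₘ σ) ⊗ₘ τ) := by
    rw [← tensorHom_id, tensorHom_comp_tensorHom, Category.id_comp]
  have h₂ : t ⊗ₘ ((λ_ (𝟙_ C)).inv ≫ (σ ⊗ₘ τ) ≫ a) =
      𝟙_ C ◁ (λ_ (𝟙_ C)).inv ≫ (t ⊗ₘ (σ ⊗ₘ τ)) ≫ A ◁ a := by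
    rw [← id_tensorHom, ← id_tensorHom, tensorHom_comp_tensorHom, tensorHom_comp_tensorHom,
      Category.id_comp, Category.comp_id]
  rw [h₁, h₂, Category.assoc, associator_naturality_assoc]
  simp only [← Category.assoc]
  congr 2
  monoidal

theorem leftUnitor_inv_comp_id_tensorHom {D : C} (τ : 𝟙_ C ⟶ D) :
    τ = (λ_ (𝟙_ C)).inv ≫ (𝟙 (𝟙_ C) ⊗ₘ τ) ≫ (λ_ D).hom := by
  simp

theorem leftUnitor_inv_comp_tensorHom_id (t : 𝟙_ C ⟶ A) :
    t = ((λ_ (𝟙_ C)).inv ≫ (t ⊗ₘ 𝟙 (𝟙_ C))) ≫ (ρ_ A).hom := by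
  rw [tensorHom_id, Category.assoc, rightUnitor_naturality, ← unitors_equal,
    Iso.inv_hom_id_assoc]

theorem comp_rightUnitor_inv (t : 𝟙_ C ⟶ A) :
    t ≫ (ρ_ A).inv = (λ_ (𝟙_ C)).inv ≫ (t ⊗ₘ 𝟙 (𝟙_ C)) := by
  rw [Iso.comp_inv_eq, ← leftUnitor_inv_comp_tensorHom_id]

/-- The pair case of the substitution lemma and of matching. -/
theorem split_comp_tensorHom {B₁ B₂ : C} (h : σ ≫ s = s' ≫ (σ₁ ⊗ₘ σ₂)) {v₁ : Y₁ ⟶ B₁}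
    {v₂ : Y₂ ⟶ B₂} {w₁ : X₂ ⟶ B₁} {w₂ : Z ⟶ B₂} (h₁ : σ₁ ≫ v₁ = w₁) (h₂ : σ₂ ≫ v₂ = w₂) :
    σ ≫ s ≫ (v₁ ⊗ₘ v₂) = s' ≫ (w₁ ⊗ₘ w₂) := by
  rw [← Category.assoc, h, Category.assoc, tensorHom_comp_tensorHom, h₁, h₂]

/-- The inductive step for matching a pair against a pattern. -/
theorem tensorHom_comp_append {X B₁ B₂ : C} {l : X ⟶ X₂ ⊗ Z} {w₁ : X₂ ⟶ B₁} {w₂ : Z ⟶ B₂}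
    {p₁ : B₁ ⟶ Y₁} {p₂ : B₂ ⟶ Y₂} (h₁ : w₁ ≫ p₁ = σ₁) (h₂ : w₂ ≫ p₂ = σ₂) (a : Y₁ ⊗ Y₂ ⟶ Y) :
    (l ≫ (w₁ ⊗ₘ w₂)) ≫ (p₁ ⊗ₘ p₂) ≫ a = l ≫ (σ₁ ⊗ₘ σ₂) ≫ a := by
  rw [Category.assoc, tensorHom_comp_tensorHom_assoc, h₁, h₂]

/-- The `let` case of the substitution lemma: `σ₁` acts on the bound term, and `k`, which extends
`σ₂` by the bound variables, on the body. -/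
theorem split_comp_letp {B G H H' D : C} (h : σ ≫ s = s' ≫ (σ₁ ⊗ₘ σ₂)) {t₁ : Y₁ ⟶ B} {p : B ⟶ G}
    {a : G ⊗ Y₂ ⟶ H} {a' : G ⊗ Z ⟶ H'} {k : H' ⟶ H} (hk : a' ≫ k = G ◁ σ₂ ≫ a) (t₂ : H ⟶ D) :
    (s' ≫ (((σ₁ ≫ t₁) ≫ p) ⊗ₘ 𝟙 Z)) ≫ a' ≫ k ≫ t₂ =
      σ ≫ (s ≫ ((t₁ ≫ p) ⊗ₘ 𝟙 Y₂)) ≫ a ≫ t₂ := by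
  rw [← Category.assoc σ, ← Category.assoc σ, h, ← Category.assoc a', hk]
  simp only [Category.assoc]
  rw [← id_tensorHom, tensorHom_comp_tensorHom_assoc, tensorHom_comp_tensorHom_assoc,
    Category.comp_id, Category.comp_id, Category.id_comp]

variable [BraidedCategory C]

theorem split_keep_right (h : σ ≫ s = s' ≫ (σ₁ ⊗ₘ σ₂)) :
    A ◁ σ ≫ A ◁ s ≫ (α_ _ _ _).inv ≫ (β_ _ _).hom ▷ _ ≫ (α_ _ _ _).hom =
      (A ◁ s' ≫ (α_ _ _ _).inv ≫ (β_ _ _).hom ▷ _ ≫ (α_ _ _ _).hom) ≫ (σ₁ ⊗ₘ A ◁ σ₂) := by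
  have h₁ := split_keep_left (A := A) h
  rw [← Category.assoc (A ◁ s), ← Category.assoc (A ◁ σ), h₁]
  simp only [Category.assoc]
  congr 2
  rw [← id_tensorHom A σ₁, ← id_tensorHom A σ₂, ← associator_naturality, ← tensorHom_id,
    ← tensorHom_id, tensorHom_comp_tensorHom_assoc, tensorHom_comp_tensorHom_assoc,
    BraidedCategory.braiding_naturality, Category.comp_id, Category.id_comp]

theorem split_put_right {t : 𝟙_ C ⟶ A} (h : σ ≫ s = s' ≫ (σ₁ ⊗ₘ σ₂)) :
    ((λ_ _).inv ≫ (t ⊗ₘ σ)) ≫ A ◁ s ≫ (α_ _ _ _).inv ≫ (β_ _ _).hom ▷ _ ≫ (α_ _ _ _).hom =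
      s' ≫ (σ₁ ⊗ₘ ((λ_ _).inv ≫ (t ⊗ₘ σ₂))) := by
  have h₁ := split_put_left (t := t) h
  rw [← Category.assoc (A ◁ s), ← Category.assoc ((λ_ X₁).inv ≫ (t ⊗ₘ σ)), h₁, Category.assoc]
  congr 1
  rw [← tensorHom_id, tensorHom_comp_tensorHom_assoc, Category.comp_id, Category.assoc,
    BraidedCategory.braiding_naturality, ← Category.assoc, leftUnitor_inv_braiding,
    ← Category.id_comp σ₂, ← tensorHom_comp_tensorHom, Category.assoc, associator_naturality,
    tensorHom_id, ← Category.assoc,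
    show (ρ_ X₂).inv ▷ Z ≫ (α_ _ _ _).hom = X₂ ◁ (λ_ Z).inv by monoidal, ← id_tensorHom,
    tensorHom_comp_tensorHom, Category.id_comp, Category.id_comp]

end Coherence

/-! ### Substitution of terms in the semantics -/

section Subst

variable {C : Type u} [Category.{v} C] [MonoidalCategory C] [SymmetricCategory C]
  [JoinInverseCategory C] [DisjointnessTensor C] [JoinInverseRigCategory C]
  [HasEmbeddingColimits C] {Ψ : ICtx}

namespace TSub

/-- The interpretation `⟦Θ⟧ ⟶ ⟦Δ⟧` of a substitution for the variables of `Δ` that keeps the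
variables of `Θ`. -/
noncomputable def sem (g : (icDom C Ψ).carrier) : {Δ Θ : Ctx} → TSub Ψ Δ Θ →
    (ctxObj C Θ ⟶ ctxObj C Δ)
  | _, _, .nil => 𝟙 (𝟙_ C)
  | _, _, .keep (A := A) σ => Ty.obj C A ◁ sem g σ
  | _, _, .put t σ => (λ_ _).inv ≫ (t.sem g ⊗ₘ sem g σ)

variable (g : (icDom C Ψ).carrier)

/-- Splitting the context after a substitution is the same as splitting the kept variables and
substituting on both sides. -/
theorem sem_split : ∀ {Δ Δ₁ Δ₂ Θ : Ctx} (s : Split Δ Δ₁ Δ₂) (σ : TSub Ψ Δ Θ),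
    σ.sem g ≫ s.sem = (split s σ).2.2.1.sem ≫
      ((split s σ).2.2.2.1.sem g ⊗ₘ (split s σ).2.2.2.2.sem g)
  | _, _, _, _, .nil, .nil => by
      change 𝟙 (𝟙_ C) ≫ (λ_ (𝟙_ C)).inv = (λ_ (𝟙_ C)).inv ≫ (𝟙 (𝟙_ C) ⊗ₘ 𝟙 (𝟙_ C))
      simp
  | _, _, _, _, .left s, .keep σ => split_keep_left (sem_split s σ)
  | _, _, _, _, .left s, .put _ σ => split_put_left (sem_split s σ)
  | _, _, _, _, .right s, .keep σ => split_keep_right (sem_split s σ)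
  | _, _, _, _, .right s, .put _ σ => split_put_right (sem_split s σ)

theorem sem_merge : ∀ {Δ Δ₁ Δ₂ : Ctx} (s : Split Δ Δ₁ Δ₂) (σ : TSub Ψ Δ₁ [])
    (τ : TSub Ψ Δ₂ []), (merge s σ τ).sem g ≫ s.sem = (λ_ (𝟙_ C)).inv ≫ (σ.sem g ⊗ₘ τ.sem g)
  | _, _, _, .nil, .nil, .nil => by
      change 𝟙 (𝟙_ C) ≫ (λ_ (𝟙_ C)).inv = (λ_ (𝟙_ C)).inv ≫ (𝟙 (𝟙_ C) ⊗ₘ 𝟙 (𝟙_ C))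
      simp
  | _, _, _, .left s, .put _ σ, τ => split_put_left (sem_merge s σ τ)
  | _, _, _, .right s, σ, .put _ τ => split_put_right (sem_merge s σ τ)

theorem sem_append : ∀ {Γ Δ : Ctx} (σ : TSub Ψ Γ []) (τ : TSub Ψ Δ []),
    (append σ τ).sem g = (λ_ (𝟙_ C)).inv ≫ (σ.sem g ⊗ₘ τ.sem g) ≫ appendSem Γ Δ
  | _, Δ, .nil, τ => by
      exact leftUnitor_inv_comp_id_tensorHom (τ.sem g)
  | A :: Γ, Δ, .put t σ, τ => by
      change (λ_ (𝟙_ C)).inv ≫ (t.sem g ⊗ₘ (append σ τ).sem g) = _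
      rw [sem_append σ τ]
      exact (append_put _).symm

theorem sem_keeps : ∀ (Γ : Ctx) {Δ Θ : Ctx} (σ : TSub Ψ Δ Θ),
    appendSem Γ Θ ≫ (keeps Γ σ).sem g = ctxObj C Γ ◁ σ.sem g ≫ appendSem Γ Δ
  | [], _, _, σ => (leftUnitor_naturality (σ.sem g)).symm
  | A :: Γ, Δ, Θ, σ => by
      change ((α_ _ _ _).hom ≫ Ty.obj C A ◁ appendSem Γ Θ) ≫ Ty.obj C A ◁ (keeps Γ σ).sem g =
        (Ty.obj C A ⊗ ctxObj C Γ) ◁ σ.sem g ≫ (α_ _ _ _).hom ≫ Ty.obj C A ◁ appendSem Γ Δ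
      rw [Category.assoc, ← whiskerLeft_comp, sem_keeps Γ σ]
      simp

end TSub

/-- Substitution is interpreted by composition. -/
theorem Tm.sem_subst (g : (icDom C Ψ).carrier) : ∀ {Δ : Ctx} {A : Ty 0} (t : Tm Ψ Δ A)
    {Θ : Ctx} (σ : TSub Ψ Δ Θ), (t.subst σ).sem g = σ.sem g ≫ t.sem g
  | _, _, .unit, _, .nil => (Category.comp_id _).symm
  | _, _, .var (A := A), _, .keep .nil => by
      change (ρ_ (Ty.obj C A)).hom = Ty.obj C A ◁ 𝟙 (𝟙_ C) ≫ (ρ_ (Ty.obj C A)).hom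
      simp
  | _, _, .var, _, .put t .nil => leftUnitor_inv_comp_tensorHom_id (t.sem g)
  | _, _, .inl t, _, σ =>
      (congrArg (fun f => f ≫ injl _ _) (Tm.sem_subst g t σ)).trans (Category.assoc _ _ _)
  | _, _, .inr t, _, σ =>
      (congrArg (fun f => f ≫ injr _ _) (Tm.sem_subst g t σ)).trans (Category.assoc _ _ _)
  | _, _, .pair s t₁ t₂, _, σ =>
      (split_comp_tensorHom (TSub.sem_split g s σ) (Tm.sem_subst g t₁ _).symm
        (Tm.sem_subst g t₂ _).symm).symm
  | _, _, .fold t, _, σ =>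
      (congrArg (fun f => f ≫ Ty.fold C _) (Tm.sem_subst g t σ)).trans (Category.assoc _ _ _)
  | _, _, .app (A := A) (B := B) w t, _, σ =>
      (congrArg (fun f => CategoryStruct.comp (Z := Ty.obj C B) f (w.sem g))
        (Tm.sem_subst g t σ)).trans (Category.assoc _ _ _)
  | _, _, .letp (Γ := Γ) s p t₁ t₂, _, σ => by
      refine (congrArg₂ (fun f k => ((TSub.split s σ).2.2.1.sem ≫ ((f ≫ p.sem) ⊗ₘ 𝟙 _)) ≫
        appendSem _ _ ≫ k) (Tm.sem_subst g t₁ _) (Tm.sem_subst g t₂ _)).trans ?_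
      exact split_comp_letp (TSub.sem_split g s σ)
        (TSub.sem_keeps g Γ (TSub.split s σ).2.2.2.2) (t₂.sem g)

/-! ### Values and evaluation -/

variable (g : (icDom C Ψ).carrier)

theorem Split.isIso_sem : ∀ {Δ Δ₁ Δ₂ : Ctx} (s : Split Δ Δ₁ Δ₂), IsIso (s.sem (C := C))
  | _, _, _, .nil => inferInstanceAs (IsIso (λ_ (𝟙_ C)).inv)
  | _, _, _, .left (A := A) s =>
      have := s.isIso_sem
      inferInstanceAs (IsIso (Ty.obj C A ◁ s.sem ≫ (α_ _ _ _).inv))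
  | _, _, _, .right (A := A) s =>
      have := s.isIso_sem
      inferInstanceAs (IsIso
        (Ty.obj C A ◁ s.sem ≫ (α_ _ _ _).inv ≫ (β_ _ _).hom ▷ _ ≫ (α_ _ _ _).hom))

theorem IsVal.total {Δ : Ctx} {A : Ty 0} {t : Tm Ψ Δ A} (ht : IsVal t) :
    Total (t.sem g) := by
  induction ht with
  | unit => exact total_of_isIso (𝟙 (𝟙_ C))
  | @var A => exact total_of_isIso (ρ_ (Ty.obj C A)).hom
  | inl _ ih => exact ih.comp (DisjointnessTensor.inl_total _ _)
  | inr _ ih => exact ih.comp (DisjointnessTensor.inr_total _ _)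
  | pair s _ _ ih₁ ih₂ =>
    have := s.isIso_sem (C := C)
    exact (total_of_isIso s.sem).comp (ih₁.tensorHom ih₂)
  | fold _ ih =>
    have := isIso_fold (C := C)
    exact ih.comp (total_of_isIso (Ty.fold C _))

/-- If `v` matches `w` with `σ`, then `w` has the denotation of `σ(v)`. -/
theorem Match.sem_comp {Δ : Ctx} {A : Ty 0} {v : Tm Ψ Δ A} {w : Tm Ψ [] A} {σ : TSub Ψ Δ []}
    (h : Match v w σ) : σ.sem g ≫ v.sem g = w.sem g := by
  induction h with
  | unit => exact Category.comp_id _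
  | var w => exact (Tm.sem_subst g (Tm.var) (.put w .nil)).symm
  | inl _ ih => exact (Category.assoc _ _ _).symm.trans (congrArg (fun f => f ≫ injl _ _) ih)
  | inr _ ih => exact (Category.assoc _ _ _).symm.trans (congrArg (fun f => f ≫ injr _ _) ih)
  | @pair _ _ _ _ _ s v₁ v₂ w₁ w₂ σ₁ σ₂ _ _ ih₁ ih₂ =>
    exact split_comp_tensorHom (TSub.sem_merge g s σ₁ σ₂) ih₁ ih₂
  | fold _ ih =>
    exact (Category.assoc _ _ _).symm.trans (congrArg (fun f => f ≫ Ty.fold C _) ih)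

theorem PatMatch.sem_comp {A : Ty 0} {Γ : Ctx} {p : Pat A Γ} {w : Tm Ψ [] A} {σ : TSub Ψ Γ []}
    (h : PatMatch p w σ) : w.sem g ≫ p.sem = σ.sem g := by
  induction h with
  | var w => exact comp_rightUnitor_inv (w.sem g)
  | @pair _ _ Γ₁ Γ₂ p₁ p₂ w₁ w₂ σ₁ σ₂ _ _ ih₁ ih₂ =>
    rw [TSub.sem_append]
    exact tensorHom_comp_append ih₁ ih₂ _

/-- If `w` is an instance of `vᵢ`, then all components `w ≫ vⱼ° ≫ eⱼ` with `j ≠ i` vanish by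
orthogonality, and totality of `vᵢ` makes the remaining one the instance of `eᵢ`. -/
theorem IsoTm.WF.comp_sem_clauses {A B : Ty 0} {n : ℕ} {Δ : Fin n → Ctx}
    {v : ∀ i, Tm Ψ (Δ i) A} {e : ∀ i, Tm Ψ (Δ i) B} (h : (IsoTm.clauses Δ v e).WF) (i : Fin n)
    (σ : TSub Ψ (Δ i) []) :
    CategoryStruct.comp (Z := Ty.obj C B) (σ.sem g ≫ (v i).sem g)
      ((IsoTm.clauses Δ v e).sem (C := C) g) = σ.sem g ≫ (e i).sem g := by
  have hi : (σ.sem g ≫ (v i).sem g) ≫ pinv ((v i).sem g) ≫ (e i).sem g =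
      σ.sem g ≫ (e i).sem g := by
    rw [Category.assoc, ← Category.assoc ((v i).sem g), ((h.1 i).1.total g).comp_pinv,
      Category.id_comp]
  -- each component lies below the `i`-th one, so the join is the `i`-th component
  have hj : ∀ j, (σ.sem g ≫ (v i).sem g) ≫ pinv ((v j).sem g) ≫ (e j).sem g ≤
      σ.sem g ≫ (e i).sem g := by
    intro j
    by_cases hij : j = i
    · subst hij
      exact hi.le
    · rw [Category.assoc, ← Category.assoc ((v i).sem g), (h.2.2 j i hij).1.sem_comp_pinv g,
        zeroHom_comp, comp_zeroHom]
      exact zeroHom_le _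
  rw [h.sem_clauses g, comp_join (h.compatibleSet g)]
  refine (eq_join ?_ ⟨?_, ?_⟩).symm
  · rintro _ ⟨_, ⟨j, rfl⟩, rfl⟩ _ ⟨_, ⟨k, rfl⟩, rfl⟩
    exact inverseCompatible_of_le (hj j) (hj k)
  · rintro _ ⟨_, ⟨j, rfl⟩, rfl⟩
    exact hj j
  · intro t ht
    rw [← hi]
    exact ht ⟨_, ⟨i, rfl⟩, rfl⟩

theorem Step.sem_eq {A : Ty 0} {t t' : Tm Ψ [] A} (h : Step t t') (ht : t.WF) :
    t.sem g = t'.sem g := by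
  induction h with
  | @iso A B w w' t h =>
    exact congrArg (fun f => CategoryStruct.comp (Z := Ty.obj C B) (t.sem g) f)
      (h.sem_eq ht.1 g)
  | clause Δ v e i _ hm =>
    rw [Tm.sem_subst, ← ht.1.comp_sem_clauses g i, hm.sem_comp]
    rfl
  | @letp _ _ Γ p w σ t _ hm =>
    rw [Tm.sem_subst, TSub.sem_append, ← hm.sem_comp g]
    have h : ∀ {X Y Z W V : C} (l : X ⟶ Y) (m : Y ⟶ Z) (a : Z ⟶ W) (k : W ⟶ V),
        (l ≫ m) ≫ a ≫ k = (l ≫ m ≫ a) ≫ k := by simp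
    exact h _ _ _ _
  | inl _ ih => exact congrArg (fun f => f ≫ injl _ _) (ih ht)
  | inr _ ih => exact congrArg (fun f => f ≫ injr _ _) (ih ht)
  | fold _ ih => exact congrArg (fun f => f ≫ Ty.fold C _) (ih ht)
  | pair_left u _ ih =>
    exact congrArg (fun f => (λ_ (𝟙_ C)).inv ≫ (f ⊗ₘ u.sem g)) (ih ht.1)
  | @pair_right _ _ w _ _ _ _ ih =>
    exact congrArg (fun f => (λ_ (𝟙_ C)).inv ≫ (w.sem g ⊗ₘ f)) (ih ht.2)
  | @clauses_arg _ B _ Δ v e _ _ _ ih =>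
    exact congrArg (fun f => CategoryStruct.comp (Z := Ty.obj C B) f
      ((IsoTm.clauses Δ v e).sem (C := C) g)) (ih ht.2)
  | @letp_arg _ _ Γ p t t' u _ ih =>
    exact congrArg (fun f => ((λ_ (𝟙_ C)).inv ≫ ((f ≫ p.sem) ⊗ₘ 𝟙 (𝟙_ C))) ≫
      appendSem Γ [] ≫ u.sem g) (ih ht.1)

theorem sem_eq_of_steps {A : Ty 0} {t t' : Tm Ψ [] A} (h : Relation.ReflTransGen Step t t')
    (ht : t.WF) : t.sem g = t'.sem g := by
  induction h using Relation.ReflTransGen.head_induction_on with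
  | refl => rfl
  | head h _ ih => exact (h.sem_eq g ht).trans (ih (h.wf ht))

/-- Values are total, so a value with zero denotation would make the identity of the tensor unit
zero. -/
theorem IsVal.sem_ne_zeroHom (h01 : IsEmpty (zeroObj C ≅ 𝟙_ C)) {A : Ty 0} {v : Tm Ψ [] A}
    (hv : IsVal v) : v.sem g ≠ zeroHom (𝟙_ C) (Ty.obj C A) := by
  intro h
  have ht : res (v.sem g) = 𝟙 (𝟙_ C) := hv.total g
  rw [h] at ht
  have ht := (res_zeroHom (𝟙_ C) (Ty.obj C A)).symm.trans ht
  exact h01.false (zeroObjIso ht.symm)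

end Subst

end RevIso

theorem mainTheorem4 {C : Type u} [Category.{v} C] [MonoidalCategory C] [SymmetricCategory C]
    [JoinInverseCategory C] [DisjointnessTensor C] [JoinInverseRigCategory C]
    [HasEmbeddingColimits C] :
    -- orthogonal terms have orthogonal denotations
    (∀ {Ψ : ICtx} {Δ₁ Δ₂ : Ctx} {A : Ty 0} (t₁ : Tm Ψ Δ₁ A) (t₂ : Tm Ψ Δ₂ A),
      t₁.WF → t₂.WF → Orth t₁ t₂ → ∀ g : (icDom C Ψ).carrier,
        t₂.sem g ≫ pinv (t₁.sem g) = zeroHom (ctxObj C Δ₂) (ctxObj C Δ₁)) ∧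
    -- the interpretations of the clauses of an iso are pairwise inverse compatible, and the
    -- interpretation of the iso is their join
    (∀ {Ψ : ICtx} {A B : Ty 0} {n : ℕ} (Δ : Fin n → Ctx) (v : ∀ i, Tm Ψ (Δ i) A)
      (e : ∀ i, Tm Ψ (Δ i) B), (IsoTm.clauses Δ v e).WF → ∀ g : (icDom C Ψ).carrier,
        (∀ i j, InverseCompatible (pinv ((v i).sem g) ≫ (e i).sem g)
          (pinv ((v j).sem g) ≫ (e j).sem g)) ∧
        IsLUB (Set.range fun i => pinv ((v i).sem g) ≫ (e i).sem g)
          ((IsoTm.clauses Δ v e).sem (C := C) g)) ∧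
    -- soundness
    (∀ {A : Ty 0} (t t' : Tm [] [] A), t.WF → Step t t' → t'.WF ∧ t.den C = t'.den C) ∧
    -- terminating terms have nonzero denotation
    (IsEmpty (zeroObj C ≅ 𝟙_ C) → ∀ {A : Ty 0} (t : Tm [] [] A), t.WF → Terminates t →
      t.den C ≠ zeroHom (𝟙_ C) (Ty.obj C A)) := by
  -- the only element of the interpretation of the empty context of iso-variables
  let g₀ : (icDom C []).carrier := PUnit.unit
  refine ⟨fun t₁ t₂ _ _ h g => h.sem_comp_pinv g,
    fun Δ v e h g => ⟨h.inverseCompatible g, h.isLUB_sem_clauses g⟩,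
    fun t t' ht h => ⟨h.wf ht, h.sem_eq g₀ ht⟩, fun h01 A t ht h => ?_⟩
  obtain ⟨v, hv, hs⟩ := h
  intro h0
  exact hv.sem_ne_zeroHom g₀ h01 ((sem_eq_of_steps g₀ hs ht).symm.trans h0)
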